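/- Let $X$ be a finite multiset of non-zero vectors of $\mathbb R^n$ that spans $\mathbb R^n$, equipped with an arbitrary total order $\prec$ (repeated vectors are distinct elements of $X$; $\max$ refers to $\prec$). Let $\Pi=\mathbb C[t_1,\dots,t_n]$ and $\Pi^0_j$ its homogeneous part of degree $j$; for $y\in\mathbb R^n$ put $p_y(t)=y\cdot t$, $D_y=\sum_i y(i)\,\partial/\partial t_i$, and $p_Y=\prod_{y\in Y}p_y$ for a finite multiset $Y$. *The space.* For $A\subset X$ let $\mathcal P(A)=\operatorname{span}\{p_Y: Y\subset A,\ \operatorname{rank}(A\setminus Y)=n\}$, and let $\mathcal P_-(X)=\bigcap_{x\in X}\mathcal P(X\setminus x)$ (one copy of $x$ is removed; the empty intersection is $\Pi$). The internal Hilbert series is $h_{X,-}(j)=\dim(\mathcal P_-(X)\cap\Pi^0_j)$, $j\ge 0$. *Internal bases.* $\mathbb B(X)$ is the set of $B\subset X$ that are bases of $\mathbb R^n$, and $\mathbb B_-(X)$ is the set of those $B\in\mathbb B(X)$ such that $b\ne\max(X\setminus\operatorname{span}(B\setminus b))$ for every $b\in B$. For $B\in\mathbb B(X)$ let $X(B)=\{y\in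 X: y\notin\operatorname{span}\{b\in B: b\preceq y\}\}$ and $Q_B=p_{X(B)}$. *The modified polynomials.* A facet hyperplane is a subspace $H\subset\mathbb R^n$ of dimension $n-1$ with $\operatorname{span}(X\cap H)=H$; let $\eta_H\neq0$ be a normal to $H$ and $m(H)=\#(X\setminus H)$. Fix $B\in\mathbb B_-(X)$ and let $\mathbf H$ be the set of all facet hyperplanes $H$ with $D_{\eta_H}^{m(H)-1}Q_B\ne0$. For $H\in\mathbf H$, $(X\setminus X(B))\setminus H$ consists of a single element $x_H\in B$. Let $W=\{\max(X\setminus H): H\in\mathbf H\}$. For $w\in W$ let $X_w=\{x_H: H\in\mathbf H,\ \max(X\setminus H)=w\}$ and $S_w=\bigcap\{H\in\mathbf H:\max(X\setminus H)\preceq w\}$. **Statement.** (a) For every $B\in\mathbb B_-(X)$, $W\subset X(B)$, and every $w\in W$ has a representation $w=w'+\sum_{x\in X_w}a_x x$ with $w'\in S_w$ and $a_x\in\mathbb R\setminus\{0\}$, in which $w'$ is unique. Hence $$\widetilde Q_B:=p_{X(B)\setminus W}\prod_{w\in W}p_{w'}$$ is well defined. (b) The polynomials $\widetilde Q_B$,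 $B\in\mathbb B_-(X)$, form a basis of $\mathcal P_-(X)$: they are linearly independent (in particular pairwise distinct) and span $\mathcal P_-(X)$ over $\mathbb C$. (c) For every integer $j\ge0$, $h_{X,-}(j)=\#\{B\in\mathbb B_-(X): \#X(B)=j\}$. -/

import Mathlib

/-!
A finite ordered multiset of vectors of `ℝⁿ` is a family `X : ι → (Fin n → ℝ)` over a finite
linearly ordered index type `ι`; sub-multisets are sets of indices. Polynomials have complex
coefficients, `Π = ℂ[t₁, …, tₙ]`.
-/

noncomputable section

namespace Zonotopal

/-- The span of the vectors of `X` with index in `A`. -/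
def spanOf {n : ℕ} {ι : Type*} (X : ι → Fin n → ℝ) (A : Set ι) : Submodule ℝ (Fin n → ℝ) :=
  Submodule.span ℝ (X '' A)

/-- The linear form `p_y : t ↦ y ⬝ t`. -/
def linForm {n : ℕ} (y : Fin n → ℝ) : MvPolynomial (Fin n) ℂ :=
  ∑ i, MvPolynomial.C ((y i : ℝ) : ℂ) * MvPolynomial.X i

/-- The product `p_Y` of the linear forms `p_y`, `y ∈ Y`, with multiplicities. -/
def prodForm {n : ℕ} {ι : Type*} (X : ι → Fin n → ℝ) (Y : Finset ι) : MvPolynomial (Fin n) ℂ :=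
  ∏ i ∈ Y, linForm (X i)

/-- The directional derivative `D_η = p_η(D)`. -/
def dirDeriv {n : ℕ} (η : Fin n → ℝ) : Module.End ℂ (MvPolynomial (Fin n) ℂ) :=
  ∑ i, ((η i : ℝ) : ℂ) • (MvPolynomial.pderiv i : Derivation ℂ _ (MvPolynomial (Fin n) ℂ)).toLinearMap

/-- `B` is (the index set of) a basis of `ℝⁿ` consisting of vectors of `X`: `B ∈ 𝔹(X)`. -/
def IsBasisOf {n : ℕ} {ι : Type*} (X : ι → Fin n → ℝ) (B : Finset ι) : Prop :=
  LinearIndependent ℝ (fun b : B => X b) ∧ spanOf X (B : Set ι) = ⊤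

/-- The central space `P(A)` of the sub-multiset `A` of `X`: the span of the `p_Y` for the
short subsets `Y ⊆ A`, i.e. those whose complement `A \ Y` has rank `n`. -/
def centralP {n : ℕ} {ι : Type*} (X : ι → Fin n → ℝ) (A : Set ι) :
    Submodule ℂ (MvPolynomial (Fin n) ℂ) :=
  Submodule.span ℂ {p | ∃ Y : Finset ι, (Y : Set ι) ⊆ A ∧ spanOf X (A \ (Y : Set ι)) = ⊤ ∧
    p = prodForm X Y}

/-- The internal space `P₋(X) = ⋂_{x ∈ X} P(X \ x)`; one copy of `x` is removed. -/
def internalP {n : ℕ} {ι : Type*} (X : ι → Fin n → ℝ) : Submodule ℂ (MvPolynomial (Fin n) ℂ) :=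
  ⨅ i : ι, centralP X {i}ᶜ

/-- `w = max (X \ H)`: the last vector of `X` outside `H`. -/
def IsLastOutside {n : ℕ} {ι : Type*} [LinearOrder ι] (X : ι → Fin n → ℝ)
    (H : Submodule ℝ (Fin n → ℝ)) (w : ι) : Prop :=
  X w ∉ H ∧ ∀ i, X i ∉ H → i ≤ w

/-- The set `𝔹₋(X)` of internal bases: those `B ∈ 𝔹(X)` no element `b` of which is internally
active, i.e. the last vector of `X` outside `span (B \ b)`. -/
def internalBases {n : ℕ} {ι : Type*} [LinearOrder ι] (X : ι → Fin n → ℝ) : Set (Finset ι) :=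
  {B | IsBasisOf X B ∧ ∀ b ∈ B, ¬ IsLastOutside X (spanOf X ((B : Set ι) \ {b})) b}

open Classical in
/-- `X(B) = {y ∈ X : y ∉ span {b ∈ B : b ⪯ y}}`. -/
def passiveSet {n : ℕ} {ι : Type*} [Fintype ι] [LinearOrder ι] (X : ι → Fin n → ℝ)
    (B : Finset ι) : Finset ι :=
  Finset.univ.filter fun y => X y ∉ spanOf X {b | b ∈ B ∧ b ≤ y}

/-- `Q_B = p_{X(B)}`. -/
def centralPoly {n : ℕ} {ι : Type*} [Fintype ι] [LinearOrder ι] (X : ι → Fin n → ℝ)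
    (B : Finset ι) : MvPolynomial (Fin n) ℂ :=
  prodForm X (passiveSet X B)

/-- The facet hyperplanes `F(X)`: the subspaces `H` of dimension `n - 1` spanned by `X ∩ H`. -/
def facetHyperplanes {n : ℕ} {ι : Type*} (X : ι → Fin n → ℝ) :
    Set (Submodule ℝ (Fin n → ℝ)) :=
  {H | Module.finrank ℝ H + 1 = n ∧ spanOf X {i | X i ∈ H} = H}

/-- `m(H) = #(X \ H)`. -/
def numOutside {n : ℕ} {ι : Type*} (X : ι → Fin n → ℝ) (H : Submodule ℝ (Fin n → ℝ)) : ℕ :=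
  Set.ncard {i | X i ∉ H}

/-- The facet hyperplanes `H` with `D_{η_H}^{m(H)-1} Q_B ≠ 0`, where `η_H` is a non-zero normal
to `H` (unique up to a non-zero factor, so that its choice is immaterial). -/
def badHyperplanes {n : ℕ} {ι : Type*} [Fintype ι] [LinearOrder ι] (X : ι → Fin n → ℝ)
    (B : Finset ι) : Set (Submodule ℝ (Fin n → ℝ)) :=
  {H | H ∈ facetHyperplanes X ∧ ∃ η : Fin n → ℝ, η ≠ 0 ∧ (∀ v ∈ H, η ⬝ᵥ v = 0) ∧
    (dirDeriv η ^ (numOutside X H - 1)) (centralPoly X B) ≠ 0}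

open Classical in
/-- `W = {max (X \ H)}`, with `H` ranging over `badHyperplanes X B`. -/
def replacedSet {n : ℕ} {ι : Type*} [Fintype ι] [LinearOrder ι] (X : ι → Fin n → ℝ)
    (B : Finset ι) : Finset ι :=
  Finset.univ.filter fun w => ∃ H ∈ badHyperplanes X B, IsLastOutside X H w

open Classical in
/-- The set (`X_i` for `w = w_i`) of the elements `x_H`, with `H` ranging over the members of
`badHyperplanes X B` such that `max (X \ H) = w`; here `x_H` is the only vector outside `H` of
the multiset `X \ X(B)`. -/
def shieldSet {n : ℕ} {ι : Type*} [Fintype ι] [LinearOrder ι] (X : ι → Fin n → ℝ)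
    (B : Finset ι) (w : ι) : Finset ι :=
  Finset.univ.filter fun x => ∃ H ∈ badHyperplanes X B, IsLastOutside X H w ∧
    {i | i ∉ passiveSet X B ∧ X i ∉ H} = {x}

/-- The intersection (`S_i` for `w = w_i`) of all `H` in `badHyperplanes X B` such that
`max (X \ H) ⪯ w`. -/
def flag {n : ℕ} {ι : Type*} [Fintype ι] [LinearOrder ι] (X : ι → Fin n → ℝ)
    (B : Finset ι) (w : ι) : Submodule ℝ (Fin n → ℝ) :=
  sInf {H | H ∈ badHyperplanes X B ∧ ∃ u, u ≤ w ∧ IsLastOutside X H u}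

/-- `v` is the vector `w'` of a representation `w = w' + ∑ aₓ x`, where `w'` lies in `flag X B w`,
the sum is over `x` in `shieldSet X B w`, and all `aₓ` are non-zero. -/
def IsReplacement {n : ℕ} {ι : Type*} [Fintype ι] [LinearOrder ι] (X : ι → Fin n → ℝ)
    (B : Finset ι) (w : ι) (v : Fin n → ℝ) : Prop :=
  v ∈ flag X B w ∧ ∃ a : ι → ℝ, (∀ x ∈ shieldSet X B w, a x ≠ 0) ∧
    X w = v + ∑ x ∈ shieldSet X B w, a x • X x

open Classical in
/-- The vector `w'` that replaces `w` (with the value `0` if there were none). -/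
def replacement {n : ℕ} {ι : Type*} [Fintype ι] [LinearOrder ι] (X : ι → Fin n → ℝ)
    (B : Finset ι) (w : ι) : Fin n → ℝ :=
  if h : ∃ v, IsReplacement X B w v then h.choose else 0

/-- The modified polynomial `Q̃_B = p_Z p_{W'}`, with `Z = X(B) \ W` and `W' = {w' : w ∈ W}`. -/
def modifiedPoly {n : ℕ} {ι : Type*} [Fintype ι] [LinearOrder ι] (X : ι → Fin n → ℝ)
    (B : Finset ι) : MvPolynomial (Fin n) ℂ :=
  prodForm X (passiveSet X B \ replacedSet X B) *
    ∏ w ∈ replacedSet X B, linForm (replacement X B w)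

/-- The internal Hilbert series `h_{X,-}(j) = dim (P₋(X) ∩ Π_j⁰)`. -/
def internalHilbert {n : ℕ} {ι : Type*} (X : ι → Fin n → ℝ) (j : ℕ) : ℕ :=
  Module.finrank ℂ
    (internalP X ⊓ MvPolynomial.homogeneousSubmodule (Fin n) ℂ j :
      Submodule ℂ (MvPolynomial (Fin n) ℂ))

end Zonotopal

end

/-! The intersection defining `internalP X` is a kernel: it consists of the polynomials killed by
$D_{\eta_H}^{m(H)-1}$ for every facet hyperplane $H$ (`internalP_eq_relKernel`). This description
and the basis theorem both rest on deletion-contraction. Contraction by a subspace $U$ is modelled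
by working modulo the ideal of the forms $p_u$, $u\in U$. If $f$ lies in the kernel for `insert a
E`, approximate it modulo $U+\langle X_a\rangle$ by a combination $g$ of known generators. Then
$f-g\equiv p_{X_a}h$ modulo the ideal of $U$, and $h$ lies in the kernel of the deletion, provided
that $g$ lies in the uncontracted kernel.

The bad hyperplanes of $B$ are the spans of $B\setminus b$ for the tight $b$ (`mem_badHyperplanes`).
In coordinates along $B$, the vector $w'$ is $w$ with its coordinates erased at those tight $b$
whose hyperplane has last outside vector $w$ (`isReplacement_iff`). So $\widetilde Q_B$ is the
product of the forms of `modVec` over $X(B)$. The heart is `card_filter_modVec_add_two_le`: at least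
two fewer modified vectors than vectors of $X$ lie off any hyperplane, which puts $\widetilde Q_B$
in the kernel.

For independence and spanning, let $E$ be a final segment and fix the part $C$ of the bases outside
$E$. The first element $a$ of $E$ splits these bases into those containing $a$ (contraction) and
those avoiding it (deletion). Erased coordinates of $X_a$ belong to earlier basis vectors, so $X_a$
and its modification agree modulo the span of $C$, and the products obey the same recursion as the
kernels. -/

noncomputable section

namespace Zonotopal

open MvPolynomial

/-! ### Linear forms and directional derivatives -/

section LinearForms

variable {n : ℕ}

lemma linForm_add (u v : Fin n → ℝ) : linForm (u + v) = linForm u + linForm v := by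
  simp [linForm, add_mul, Finset.sum_add_distrib]

lemma linForm_smul (c : ℝ) (v : Fin n → ℝ) : linForm (c • v) = C (c : ℂ) * linForm v := by
  simp [linForm, Finset.mul_sum, mul_assoc]

lemma linForm_sub (u v : Fin n → ℝ) : linForm (u - v) = linForm u - linForm v := by
  simp [linForm, sub_mul, Finset.sum_sub_distrib]

lemma linForm_single (i : Fin n) : linForm (Pi.single i 1) = X i := by
  rw [linForm, Finset.sum_eq_single i]
  · simp
  · intro j _ hj
    simp [hj]
  · simp

lemma isHomogeneous_linForm (v : Fin n → ℝ) : (linForm v).IsHomogeneous 1 :=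
  IsHomogeneous.sum _ _ _ fun i _ => isHomogeneous_C_mul_X _ i

lemma dirDeriv_apply (η : Fin n → ℝ) (f : MvPolynomial (Fin n) ℂ) :
    dirDeriv η f = ∑ i, ((η i : ℝ) : ℂ) • pderiv i f := by
  simp [dirDeriv, LinearMap.sum_apply]

lemma dirDeriv_mul (η : Fin n → ℝ) (f g : MvPolynomial (Fin n) ℂ) :
    dirDeriv η (f * g) = f * dirDeriv η g + g * dirDeriv η f := by
  simp only [dirDeriv_apply, Derivation.leibniz, smul_add, Finset.sum_add_distrib, Finset.mul_sum,
    smul_eq_mul, mul_smul_comm]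

lemma dirDeriv_C (η : Fin n → ℝ) (c : ℂ) : dirDeriv η (C c) = 0 := by
  simp [dirDeriv_apply]

lemma dirDeriv_linForm (η v : Fin n → ℝ) : dirDeriv η (linForm v) = C ((η ⬝ᵥ v : ℝ) : ℂ) := by
  simp only [dirDeriv_apply, linForm, map_sum, Derivation.leibniz, pderiv_C, pderiv_X,
    smul_eq_mul, dotProduct, Complex.ofReal_sum, Complex.ofReal_mul, C_mul]
  refine Finset.sum_congr rfl fun i _ => ?_
  rw [Finset.sum_eq_single i]
  · simp [smul_eq_C_mul]
  · intro j _ hj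
    simp [hj]
  · simp

lemma dirDeriv_pow_linForm_mul (η v : Fin n → ℝ) (g : MvPolynomial (Fin n) ℂ) (k : ℕ) :
    (dirDeriv η ^ (k + 1)) (linForm v * g) = linForm v * (dirDeriv η ^ (k + 1)) g +
      C (((k + 1 : ℕ) : ℂ) * ((η ⬝ᵥ v : ℝ) : ℂ)) * (dirDeriv η ^ k) g := by
  induction k with
  | zero => simp [dirDeriv_mul, dirDeriv_linForm, mul_comm g]
  | succ k ih =>
    rw [pow_succ', Module.End.mul_apply, ih, map_add, dirDeriv_mul, dirDeriv_mul, dirDeriv_C,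
      dirDeriv_linForm, ← Module.End.mul_apply, ← pow_succ', ← Module.End.mul_apply, ← pow_succ']
    push_cast
    simp only [C_mul, C_add, C_1]
    ring

lemma dirDeriv_pow_linForm_mul_of_eq_zero {η v : Fin n → ℝ} (h : η ⬝ᵥ v = 0)
    (g : MvPolynomial (Fin n) ℂ) (k : ℕ) :
    (dirDeriv η ^ k) (linForm v * g) = linForm v * (dirDeriv η ^ k) g := by
  cases k with
  | zero => simp
  | succ k => simp [dirDeriv_pow_linForm_mul, h]

lemma pow_apply_eq_zero_of_le {M : Type*} [AddCommGroup M] [Module ℂ M] {D : Module.End ℂ M}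
    {f : M} {k l : ℕ} (hkl : k ≤ l) (h : (D ^ k) f = 0) : (D ^ l) f = 0 := by
  rw [← Nat.sub_add_cancel hkl, pow_add, Module.End.mul_apply, h, map_zero]

lemma exists_dirDeriv_pow_eq_zero (η : Fin n → ℝ) (f : MvPolynomial (Fin n) ℂ) :
    ∃ k, (dirDeriv η ^ k) f = 0 := by
  induction f using MvPolynomial.induction_on with
  | C a => exact ⟨1, by simp [dirDeriv_C]⟩
  | add p q hp hq =>
    obtain ⟨k, hk⟩ := hp
    obtain ⟨l, hl⟩ := hq
    exact ⟨max k l, by rw [map_add, pow_apply_eq_zero_of_le (le_max_left k l) hk,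
      pow_apply_eq_zero_of_le (le_max_right k l) hl, add_zero]⟩
  | mul_X p i hp =>
    obtain ⟨k, hk⟩ := hp
    refine ⟨k + 1, ?_⟩
    rw [mul_comm, ← linForm_single, dirDeriv_pow_linForm_mul, hk,
      pow_apply_eq_zero_of_le (Nat.le_succ k) hk]
    simp

-- Each derivative along `η` must consume a factor not orthogonal to `η`.
open Classical in
lemma dirDeriv_pow_prod_eq_zero {ι : Type*} (η : Fin n → ℝ) (v : ι → Fin n → ℝ) (Y : Finset ι) :
    ∀ k, (Y.filter fun y => η ⬝ᵥ v y ≠ 0).card < k →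
      (dirDeriv η ^ k) (∏ y ∈ Y, linForm (v y)) = 0 := by
  induction Y using Finset.induction_on with
  | empty =>
    intro k hk
    refine pow_apply_eq_zero_of_le (k := 1) (Nat.succ_le_of_lt (by simpa using hk)) ?_
    simpa using dirDeriv_C η 1
  | insert a s ha ih =>
    intro k hk
    rw [Finset.prod_insert ha]
    by_cases h : η ⬝ᵥ v a = 0
    · rw [Finset.filter_insert, if_neg (by simpa using h)] at hk
      rw [dirDeriv_pow_linForm_mul_of_eq_zero h, ih k hk, mul_zero]
    · rw [Finset.filter_insert, if_pos h, Finset.card_insert_of_notMem (by simp [ha])] at hk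
      obtain ⟨k, rfl⟩ : ∃ l, k = l + 1 := ⟨k - 1, by omega⟩
      rw [dirDeriv_pow_linForm_mul, ih (k + 1) (by omega), ih k (by omega)]
      simp

end LinearForms

/-! ### Ideals generated by the forms of a subspace -/

section SubspaceIdeal

variable {n : ℕ}

/-- The ideal of the polynomials vanishing on the orthogonal complement of `U`. -/
def subspaceIdeal (U : Submodule ℝ (Fin n → ℝ)) : Ideal (MvPolynomial (Fin n) ℂ) :=
  Ideal.span (linForm '' (U : Set (Fin n → ℝ)))

lemma linForm_mem_subspaceIdeal {U : Submodule ℝ (Fin n → ℝ)} {u : Fin n → ℝ} (hu : u ∈ U) :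
    linForm u ∈ subspaceIdeal U :=
  Ideal.subset_span ⟨u, hu, rfl⟩

lemma subspaceIdeal_mono {U V : Submodule ℝ (Fin n → ℝ)} (h : U ≤ V) :
    subspaceIdeal U ≤ subspaceIdeal V :=
  Ideal.span_mono (Set.image_mono h)

lemma subspaceIdeal_bot : subspaceIdeal (⊥ : Submodule ℝ (Fin n → ℝ)) = ⊥ := by
  simp [subspaceIdeal, linForm]

lemma constantCoeff_of_mem_subspaceIdeal {U : Submodule ℝ (Fin n → ℝ)}
    {f : MvPolynomial (Fin n) ℂ} (hf : f ∈ subspaceIdeal U) : constantCoeff f = 0 := by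
  have h : subspaceIdeal U ≤ RingHom.ker (constantCoeff (σ := Fin n) (R := ℂ)) := by
    refine Ideal.span_le.2 ?_
    rintro _ ⟨u, _, rfl⟩
    simp [linForm, RingHom.mem_ker]
  exact h hf

lemma sub_C_mem_subspaceIdeal_top (f : MvPolynomial (Fin n) ℂ) :
    f - C (constantCoeff f) ∈ subspaceIdeal (⊤ : Submodule ℝ (Fin n → ℝ)) := by
  induction f using MvPolynomial.induction_on with
  | C a => simp
  | add p q hp hq =>
    have := add_mem hp hq
    rw [map_add, C_add]
    convert this using 1
    ring
  | mul_X p i _ =>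
    simp only [map_mul, constantCoeff_X, mul_zero, map_zero, sub_zero]
    rw [← linForm_single]
    exact Ideal.mul_mem_left _ _ (linForm_mem_subspaceIdeal trivial)

lemma dirDeriv_mem_subspaceIdeal {U : Submodule ℝ (Fin n → ℝ)} {η : Fin n → ℝ}
    (hη : ∀ u ∈ U, η ⬝ᵥ u = 0) {f : MvPolynomial (Fin n) ℂ} (hf : f ∈ subspaceIdeal U) :
    dirDeriv η f ∈ subspaceIdeal U := by
  induction hf using Submodule.span_induction with
  | mem _ h =>
    obtain ⟨u, hu, rfl⟩ := h
    simp [dirDeriv_linForm, hη u hu]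
  | zero => simp
  | add _ _ _ _ hx hy => simpa using add_mem hx hy
  | smul a x hx h =>
    rw [smul_eq_mul, dirDeriv_mul]
    exact add_mem (Ideal.mul_mem_left _ _ h) (Ideal.mul_mem_right _ _ hx)

lemma dirDeriv_pow_mem_subspaceIdeal {U : Submodule ℝ (Fin n → ℝ)} {η : Fin n → ℝ}
    (hη : ∀ u ∈ U, η ⬝ᵥ u = 0) {f : MvPolynomial (Fin n) ℂ} {k l : ℕ} (hkl : k ≤ l)
    (hf : (dirDeriv η ^ k) f ∈ subspaceIdeal U) : (dirDeriv η ^ l) f ∈ subspaceIdeal U := by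
  induction l, hkl using Nat.le_induction with
  | base => exact hf
  | succ l _ ih =>
    rw [pow_succ', Module.End.mul_apply]
    exact dirDeriv_mem_subspaceIdeal hη ih

lemma mem_of_C_mul_mem {I : Ideal (MvPolynomial (Fin n) ℂ)} {c : ℂ} (hc : c ≠ 0)
    {f : MvPolynomial (Fin n) ℂ} (h : C c * f ∈ I) : f ∈ I := by
  have := I.mul_mem_left (C c⁻¹) h
  rwa [← mul_assoc, ← C_mul, inv_mul_cancel₀ hc, C_1, one_mul] at this

/-- If the least exponent `m` putting `h` into the ideal were positive and at least `k`, Leibniz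
applied to the `m`-th derivative of `linForm x * h` would leave a nonzero multiple of the `(m-1)`-st
derivative of `h`, against minimality. Truncated subtraction is useful here: `k = 0` says that
`linForm x` can be cancelled. -/
lemma dirDeriv_pow_pred_mem {U : Submodule ℝ (Fin n → ℝ)} {η x : Fin n → ℝ}
    (hη : ∀ u ∈ U, η ⬝ᵥ u = 0) (hx : η ⬝ᵥ x ≠ 0) {h : MvPolynomial (Fin n) ℂ} {k : ℕ}
    (hk : (dirDeriv η ^ k) (linForm x * h) ∈ subspaceIdeal U) :
    (dirDeriv η ^ (k - 1)) h ∈ subspaceIdeal U := by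
  classical
  have hex : ∃ l, (dirDeriv η ^ l) h ∈ subspaceIdeal U := by
    obtain ⟨l, hl⟩ := exists_dirDeriv_pow_eq_zero η h
    exact ⟨l, by simp [hl]⟩
  have hspec := Nat.find_spec hex
  refine dirDeriv_pow_mem_subspaceIdeal hη ?_ hspec
  by_contra! hlt
  obtain ⟨l, hl⟩ : ∃ l, Nat.find hex = l + 1 := ⟨Nat.find hex - 1, by omega⟩
  rw [hl] at hspec hlt
  have h1 := dirDeriv_pow_mem_subspaceIdeal hη (l := l + 1) (by omega) hk
  rw [dirDeriv_pow_linForm_mul] at h1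
  have h2 := (Ideal.add_mem_iff_right _ (Ideal.mul_mem_left _ _ hspec)).1 h1
  refine Nat.find_min hex (m := l) (by omega) (mem_of_C_mul_mem ?_ h2)
  exact mul_ne_zero (by exact_mod_cast l.succ_ne_zero) (by exact_mod_cast hx)

lemma exists_normal {U : Submodule ℝ (Fin n → ℝ)} {x : Fin n → ℝ} (hx : x ∉ U) :
    ∃ η : Fin n → ℝ, (∀ u ∈ U, η ⬝ᵥ u = 0) ∧ η ⬝ᵥ x ≠ 0 := by
  obtain ⟨f, hfx, hf⟩ := Submodule.exists_dual_map_eq_bot_of_notMem hx inferInstance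
  have key : ∀ v, (fun i => f (Pi.single i 1)) ⬝ᵥ v = f v := fun v => by
    conv_rhs => rw [pi_eq_sum_univ' v]
    simp [dotProduct, mul_comm]
  refine ⟨fun i => f (Pi.single i 1), fun u hu => ?_, by rwa [key]⟩
  rw [key]
  have : f u ∈ U.map f := ⟨u, hu, rfl⟩
  simpa [hf] using this

lemma mem_subspaceIdeal_of_linForm_mul {U : Submodule ℝ (Fin n → ℝ)} {x : Fin n → ℝ}
    (hx : x ∉ U) {h : MvPolynomial (Fin n) ℂ} (hh : linForm x * h ∈ subspaceIdeal U) :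
    h ∈ subspaceIdeal U := by
  obtain ⟨η, hη, hηx⟩ := exists_normal hx
  simpa using dirDeriv_pow_pred_mem (k := 0) hη hηx (by simpa using hh)

/-- Undoes a contraction: enlarging `U` by `x` adds only the principal ideal of `linForm x`. -/
lemma exists_sub_linForm_mul_mem {U : Submodule ℝ (Fin n → ℝ)} {x : Fin n → ℝ}
    {f : MvPolynomial (Fin n) ℂ} (hf : f ∈ subspaceIdeal (U ⊔ Submodule.span ℝ {x})) :
    ∃ h, f - linForm x * h ∈ subspaceIdeal U := by
  have h : subspaceIdeal (U ⊔ Submodule.span ℝ {x}) ≤ subspaceIdeal U ⊔ Ideal.span {linForm x} := by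
    refine Ideal.span_le.2 ?_
    rintro _ ⟨u, hu, rfl⟩
    obtain ⟨v, hv, w, hw, rfl⟩ := Submodule.mem_sup.1 hu
    obtain ⟨c, rfl⟩ := Submodule.mem_span_singleton.1 hw
    rw [linForm_add, linForm_smul]
    exact Submodule.add_mem_sup (linForm_mem_subspaceIdeal hv)
      (Ideal.mul_mem_left _ _ (Ideal.mem_span_singleton_self _))
  obtain ⟨i, hi, j, hj, rfl⟩ := Submodule.mem_sup.1 (h hf)
  obtain ⟨g, rfl⟩ := Ideal.mem_span_singleton'.1 hj
  exact ⟨g, by simpa [mul_comm g] using hi⟩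

-- Factors are peeled off one by one: orthogonal ones cancel, the others lower the exponent by one.
open Classical in
lemma dirDeriv_pow_prod_ne_zero {ι : Type*} (η : Fin n → ℝ) {v : ι → Fin n → ℝ} {Y : Finset ι}
    (hv : ∀ y ∈ Y, v y ≠ 0) :
    ∀ k, k ≤ (Y.filter fun y => η ⬝ᵥ v y ≠ 0).card →
      (dirDeriv η ^ k) (∏ y ∈ Y, linForm (v y)) ≠ 0 := by
  induction Y using Finset.induction_on with
  | empty =>
    intro k hk
    obtain rfl : k = 0 := by simpa using hk
    simp
  | insert a s ha ih =>
    intro k hk h0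
    have ih' := ih fun y hy => hv y (Finset.mem_insert_of_mem hy)
    rw [Finset.prod_insert ha] at h0
    by_cases h : η ⬝ᵥ v a = 0
    · rw [Finset.filter_insert, if_neg (by simpa using h)] at hk
      rw [dirDeriv_pow_linForm_mul_of_eq_zero h] at h0
      have hva : v a ∉ (⊥ : Submodule ℝ (Fin n → ℝ)) := by
        simpa using hv a (Finset.mem_insert_self a s)
      have := mem_subspaceIdeal_of_linForm_mul (U := ⊥) hva (by rw [h0]; exact zero_mem _)
      rw [subspaceIdeal_bot] at this
      exact ih' k hk (by simpa using this)
    · rw [Finset.filter_insert, if_pos h, Finset.card_insert_of_notMem (by simp [ha])] at hk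
      have := dirDeriv_pow_pred_mem (U := ⊥) (η := η) (k := k) (h := ∏ y ∈ s, linForm (v y))
        (by simp) h (by rw [h0]; exact zero_mem _)
      rw [subspaceIdeal_bot] at this
      exact ih' (k - 1) (by omega) (by simpa using this)

end SubspaceIdeal

/-! ### Spans and hyperplanes -/

section SpanOf

variable {n : ℕ} {ι : Type*}

lemma spanOf_mono (X : ι → Fin n → ℝ) {A B : Set ι} (h : A ⊆ B) : spanOf X A ≤ spanOf X B :=
  Submodule.span_mono (Set.image_mono h)

lemma mem_spanOf (X : ι → Fin n → ℝ) {A : Set ι} {i : ι} (h : i ∈ A) : X i ∈ spanOf X A :=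
  Submodule.subset_span ⟨i, h, rfl⟩

lemma spanOf_le {X : ι → Fin n → ℝ} {A : Set ι} {H : Submodule ℝ (Fin n → ℝ)} :
    spanOf X A ≤ H ↔ ∀ i ∈ A, X i ∈ H := by
  simp [spanOf, Submodule.span_le, Set.subset_def]

lemma spanOf_insert (X : ι → Fin n → ℝ) (a : ι) (A : Set ι) :
    spanOf X (insert a A) = Submodule.span ℝ {X a} ⊔ spanOf X A := by
  simp [spanOf, Set.image_insert_eq, Submodule.span_insert]

lemma spanOf_empty (X : ι → Fin n → ℝ) : spanOf X ∅ = ⊥ := by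
  simp [spanOf]

lemma ne_top_of_finrank_add_one {H : Submodule ℝ (Fin n → ℝ)} (hH : Module.finrank ℝ H + 1 = n) :
    H ≠ ⊤ := by
  rintro rfl
  simp at hH

lemma exists_notMem_of_sup_eq_top {X : ι → Fin n → ℝ} {A : Set ι}
    {U H : Submodule ℝ (Fin n → ℝ)} (hA : U ⊔ spanOf X A = ⊤) (hU : U ≤ H) (hH : H ≠ ⊤) :
    ∃ i ∈ A, X i ∉ H := by
  by_contra! h
  exact hH (top_le_iff.1 (hA ▸ sup_le hU (spanOf_le.2 h)))

lemma finrank_add_one_of_sup_span_singleton {V : Submodule ℝ (Fin n → ℝ)} {x : Fin n → ℝ}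
    (hV : V ≠ ⊤) (h : Submodule.span ℝ {x} ⊔ V = ⊤) : Module.finrank ℝ V + 1 = n := by
  have h1 := Submodule.finrank_add_le_finrank_add_finrank (Submodule.span ℝ {x}) V
  rw [h, finrank_top, Module.finrank_fin_fun] at h1
  have h2 := finrank_span_le_card (R := ℝ) ({x} : Set (Fin n → ℝ))
  rw [Set.toFinset_singleton, Finset.card_singleton] at h2
  have h3 := Submodule.finrank_lt hV
  rw [Module.finrank_fin_fun] at h3
  omega

lemma dotProduct_eq_zero_iff_mem {H : Submodule ℝ (Fin n → ℝ)} (hH : Module.finrank ℝ H + 1 = n)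
    {η : Fin n → ℝ} (h0 : η ≠ 0) (hη : ∀ v ∈ H, η ⬝ᵥ v = 0) {x : Fin n → ℝ} :
    η ⬝ᵥ x = 0 ↔ x ∈ H := by
  refine ⟨fun hx => ?_, hη x⟩
  by_contra hxH
  have htop : Submodule.span ℝ {x} ⊔ H = ⊤ := by
    refine Submodule.eq_top_of_finrank_eq ?_
    have hlt : H < Submodule.span ℝ {x} ⊔ H := by
      refine lt_of_le_of_ne le_sup_right fun h => hxH ?_
      rw [h]
      exact Submodule.mem_sup_left (Submodule.mem_span_singleton_self _)
    have h5 := Submodule.finrank_lt_finrank_of_lt hlt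
    have h6 := Submodule.finrank_le (Submodule.span ℝ {x} ⊔ H)
    rw [Module.finrank_fin_fun] at h6 ⊢
    omega
  refine h0 (dotProduct_eq_zero _ fun v => ?_)
  obtain ⟨y, hy, z, hz, rfl⟩ := Submodule.mem_sup.1 (htop ▸ Submodule.mem_top : v ∈ _)
  obtain ⟨c, rfl⟩ := Submodule.mem_span_singleton.1 hy
  simp [dotProduct_add, hx, hη z hz]

end SpanOf

/-! ### Relative kernels under deletion and contraction -/

section RelativeKernel

variable {n : ℕ} {ι : Type*}

open Classical in
/-- The polynomials annihilated, modulo `subspaceIdeal U`, by the powers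
`D_{η_H}^{m(H) - d}`, where `H` runs over the facet hyperplanes of the sub-multiset `E`
of `X` contracted by `U`, and `m(H)` counts the elements of `E` outside `H`. -/
def relKernel (X : ι → Fin n → ℝ) (E : Finset ι) (U : Submodule ℝ (Fin n → ℝ)) (d : ℕ) :
    Submodule ℂ (MvPolynomial (Fin n) ℂ) where
  carrier := {f | ∀ H : Submodule ℝ (Fin n → ℝ), Module.finrank ℝ H + 1 = n → U ≤ H →
    H ≤ U ⊔ spanOf X {i | i ∈ E ∧ X i ∈ H} → ∀ η : Fin n → ℝ, η ≠ 0 →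
      (∀ v ∈ H, η ⬝ᵥ v = 0) → (dirDeriv η ^ ((E.filter fun i => X i ∉ H).card - d)) f ∈
        subspaceIdeal U}
  add_mem' := by
    intro f g hf hg H h1 h2 h3 η h0 h4
    rw [map_add]
    exact add_mem (hf H h1 h2 h3 η h0 h4) (hg H h1 h2 h3 η h0 h4)
  zero_mem' := by
    intro H _ _ _ η _ _
    simp
  smul_mem' := by
    intro c f hf H h1 h2 h3 η h0 h4
    rw [map_smul, smul_eq_C_mul]
    exact Ideal.mul_mem_left _ _ (hf H h1 h2 h3 η h0 h4)

lemma subspaceIdeal_le_relKernel {X : ι → Fin n → ℝ} {E : Finset ι}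
    {U : Submodule ℝ (Fin n → ℝ)} {d : ℕ} {f : MvPolynomial (Fin n) ℂ}
    (hf : f ∈ subspaceIdeal U) : f ∈ relKernel X E U d :=
  fun _ _ h2 _ _ _ h4 =>
    dirDeriv_pow_mem_subspaceIdeal (fun u hu => h4 u (h2 hu)) (k := 0) (Nat.zero_le _) hf

-- The facet hyperplanes of the contraction are among those of the original set; they contain `X a`,
-- so `a` is not counted and the exponents agree.
open Classical in
lemma relKernel_contract [DecidableEq ι] {X : ι → Fin n → ℝ} {E : Finset ι}
    {U : Submodule ℝ (Fin n → ℝ)} {d : ℕ} {a : ι} {f : MvPolynomial (Fin n) ℂ}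
    (hf : f ∈ relKernel X (insert a E) U d) :
    f ∈ relKernel X E (U ⊔ Submodule.span ℝ {X a}) d := by
  intro H h1 h2 h3 η h0 h4
  have haH : X a ∈ H := h2 (Submodule.mem_sup_right (Submodule.mem_span_singleton_self _))
  refine subspaceIdeal_mono le_sup_left ?_
  have := hf H h1 (le_sup_left.trans h2) (h3.trans ?_) η h0 h4
  · rwa [Finset.filter_insert, if_neg (by simpa using haH)] at this
  · rw [sup_assoc, ← spanOf_insert]
    refine sup_le_sup le_rfl (spanOf_mono X ?_)
    rintro i (rfl | hi)
    · exact ⟨Finset.mem_insert_self _ _, haH⟩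
    · exact ⟨Finset.mem_insert_of_mem hi.1, hi.2⟩

open Classical in
lemma relKernel_loop [DecidableEq ι] {X : ι → Fin n → ℝ} {E : Finset ι}
    {U : Submodule ℝ (Fin n → ℝ)} {d : ℕ} {a : ι} (ha : X a ∈ U) {f : MvPolynomial (Fin n) ℂ}
    (hf : f ∈ relKernel X (insert a E) U d) :
    f ∈ relKernel X E U d := by
  have := relKernel_contract hf
  rwa [sup_eq_left.2 ((Submodule.span_singleton_le_iff_mem _ _).2 ha)] at this

-- If `X a ∈ H`, the factor cancels and the exponent stays. Otherwise losing the factor costs one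
-- derivative, exactly as `m(H)` drops by one.
open Classical in
lemma relKernel_delete [DecidableEq ι] {X : ι → Fin n → ℝ} {E : Finset ι}
    {U : Submodule ℝ (Fin n → ℝ)} {d : ℕ} {a : ι} (ha : a ∉ E) {f : MvPolynomial (Fin n) ℂ}
    (haU : X a ∉ U) (hf : linForm (X a) * f ∈ relKernel X (insert a E) U d) :
    f ∈ relKernel X E U d := by
  intro H h1 h2 h3 η h0 h4
  have := hf H h1 h2 (h3.trans (sup_le_sup le_rfl (spanOf_mono X
    fun i hi => ⟨Finset.mem_insert_of_mem hi.1, hi.2⟩))) η h0 h4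
  have hU : ∀ u ∈ U, η ⬝ᵥ u = 0 := fun u hu => h4 u (h2 hu)
  by_cases haH : X a ∈ H
  · rw [Finset.filter_insert, if_neg (by simpa using haH),
      dirDeriv_pow_linForm_mul_of_eq_zero (h4 _ haH)] at this
    exact mem_subspaceIdeal_of_linForm_mul haU this
  · rw [Finset.filter_insert, if_pos haH, Finset.card_insert_of_notMem (by simp [ha])] at this
    have := dirDeriv_pow_pred_mem hU (mt (dotProduct_eq_zero_iff_mem h1 h0 h4).1 haH) this
    rwa [Nat.sub_right_comm, Nat.add_sub_cancel] at this

-- For a coloop `a`, the hyperplane `U ⊔ spanOf X E` misses only `a`, so `m(H) = 1`.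
open Classical in
lemma relKernel_coloop [DecidableEq ι] {X : ι → Fin n → ℝ} {E : Finset ι}
    {U : Submodule ℝ (Fin n → ℝ)} {d : ℕ} {a : ι} (hE : U ⊔ spanOf X E ≠ ⊤)
    (haE : U ⊔ spanOf X (insert a E : Finset ι) = ⊤)
    {f : MvPolynomial (Fin n) ℂ} (hf : f ∈ relKernel X (insert a E) U d) :
    ∃ η : Fin n → ℝ, (∀ u ∈ U, η ⬝ᵥ u = 0) ∧ η ⬝ᵥ X a ≠ 0 ∧
      (dirDeriv η ^ (1 - d)) f ∈ subspaceIdeal U := by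
  set H := U ⊔ spanOf X E with hH
  have htop : Submodule.span ℝ {X a} ⊔ H = ⊤ := by
    rw [hH, sup_left_comm, ← spanOf_insert, ← haE, Finset.coe_insert]
  have haH : X a ∉ H := fun h => hE (by
    rwa [sup_eq_right.2 ((Submodule.span_singleton_le_iff_mem _ _).2 h)] at htop)
  have hEH : ∀ i ∈ E, X i ∈ H := fun i hi => Submodule.mem_sup_right (mem_spanOf X hi)
  obtain ⟨η, hη, hηa⟩ := exists_normal haH
  refine ⟨η, fun u hu => hη u (Submodule.mem_sup_left hu), hηa, ?_⟩
  have := hf H (finrank_add_one_of_sup_span_singleton hE htop) le_sup_left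
    (sup_le_sup le_rfl (spanOf_mono X fun i hi => ⟨Finset.mem_insert_of_mem hi, hEH i hi⟩)) η
    (fun h => hηa (by simp [h])) hη
  rwa [Finset.filter_insert, if_pos haH, Finset.filter_false_of_mem (by simpa using hEH)] at this

open Classical in
lemma prodForm_mem_relKernel {X : ι → Fin n → ℝ} {E Y : Finset ι} {U : Submodule ℝ (Fin n → ℝ)}
    (hYE : Y ⊆ E) (hY : U ⊔ spanOf X ((E : Set ι) \ Y) = ⊤) :
    prodForm X Y ∈ relKernel X E U 0 := by
  intro H h1 h2 _ η _ h4
  rw [prodForm, dirDeriv_pow_prod_eq_zero η X Y _ ?_]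
  · exact zero_mem _
  obtain ⟨i, hi, hiH⟩ := exists_notMem_of_sup_eq_top hY h2 (ne_top_of_finrank_add_one h1)
  refine Finset.card_lt_card ⟨fun y hy => ?_, fun h => hi.2 ?_⟩
  · simp only [Finset.mem_filter] at hy ⊢
    exact ⟨hYE hy.1, mt (h4 _) hy.2⟩
  · exact (Finset.mem_filter.1 (h (Finset.mem_filter.2 ⟨hi.1, hiH⟩))).1

open Classical in
/-- The central space, relative to the contraction by a subspace `U`, contains `relKernel`
modulo `subspaceIdeal U`. -/
lemma exists_sub_mem_of_mem_relKernel_zero (X : ι → Fin n → ℝ) (E : Finset ι) :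
    ∀ U : Submodule ℝ (Fin n → ℝ), U ⊔ spanOf X E = ⊤ → ∀ f ∈ relKernel X E U 0,
      ∃ g ∈ Submodule.span ℂ {p | ∃ Y : Finset ι, Y ⊆ E ∧ U ⊔ spanOf X ((E : Set ι) \ Y) = ⊤ ∧
        p = prodForm X Y}, f - g ∈ subspaceIdeal U := by
  induction E using Finset.induction_on with
  | empty =>
    intro U hU f _
    rw [Finset.coe_empty, spanOf_empty, sup_bot_eq] at hU
    subst hU
    refine ⟨C (constantCoeff f), ?_, sub_C_mem_subspaceIdeal_top f⟩
    rw [← mul_one (C _), ← smul_eq_C_mul]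
    exact Submodule.smul_mem _ _ (Submodule.subset_span
      ⟨∅, subset_rfl, by simp, by simp [prodForm]⟩)
  | insert a E ha ih =>
    intro U hU f hf
    by_cases haU : X a ∈ U
    · have hE : U ⊔ spanOf X E = ⊤ := by
        rwa [Finset.coe_insert, spanOf_insert, ← sup_assoc,
          sup_eq_left.2 ((Submodule.span_singleton_le_iff_mem _ _).2 haU)] at hU
      obtain ⟨g, hg, hfg⟩ := ih U hE f (relKernel_loop haU hf)
      refine ⟨g, Submodule.span_mono ?_ hg, hfg⟩
      rintro p ⟨Y, hYE, hY, rfl⟩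
      refine ⟨Y, hYE.trans (Finset.subset_insert _ _), top_le_iff.1 ?_, rfl⟩
      rw [← hY]
      exact sup_le_sup le_rfl (spanOf_mono X (Set.sdiff_subset_sdiff_left (by simp)))
    obtain ⟨g, hg, hfg⟩ := ih (U ⊔ Submodule.span ℝ {X a})
      (by rwa [sup_assoc, ← spanOf_insert, ← Finset.coe_insert]) f (relKernel_contract hf)
    have hg' : g ∈ Submodule.span ℂ {p | ∃ Y : Finset ι, Y ⊆ insert a E ∧
        U ⊔ spanOf X (((insert a E : Finset ι) : Set ι) \ Y) = ⊤ ∧ p = prodForm X Y} := by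
      refine Submodule.span_mono ?_ hg
      rintro p ⟨Y, hYE, hY, rfl⟩
      refine ⟨Y, hYE.trans (Finset.subset_insert _ _), ?_, rfl⟩
      rw [sup_assoc, ← spanOf_insert] at hY
      rwa [Finset.coe_insert, Set.insert_sdiff_of_notMem _ (by simpa using fun h => ha (hYE h))]
    have hgk : g ∈ relKernel X (insert a E) U 0 := by
      refine Submodule.span_le.2 ?_ hg'
      rintro p ⟨Y, hYE, hY, rfl⟩
      exact prodForm_mem_relKernel hYE hY
    -- The error of the approximation in the contraction is a multiple of `linForm (X a)`; it lies
    -- in the uncontracted kernel because `f` and `g` do.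
    obtain ⟨h, hh⟩ := exists_sub_linForm_mul_mem hfg
    have hk : linForm (X a) * h ∈ relKernel X (insert a E) U 0 := by
      have := sub_mem (sub_mem hf hgk) (subspaceIdeal_le_relKernel hh)
      rwa [sub_sub_cancel] at this
    by_cases hE : U ⊔ spanOf X E = ⊤
    · obtain ⟨q, hq, hhq⟩ := ih U hE h (relKernel_delete ha haU hk)
      refine ⟨g + linForm (X a) * q, add_mem hg' ?_, ?_⟩
      · clear hhq
        induction hq using Submodule.span_induction with
        | mem p hp =>
          obtain ⟨Y, hYE, hY, rfl⟩ := hp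
          refine Submodule.subset_span ⟨insert a Y, Finset.insert_subset_insert _ hYE, ?_, ?_⟩
          · convert hY using 3
            ext i
            simp only [Finset.coe_insert, Set.mem_sdiff, Set.mem_insert_iff, Finset.mem_coe]
            grind
          · rw [prodForm, prodForm, Finset.prod_insert fun h => ha (hYE h)]
        | zero => simp
        | add p q _ _ hp hq =>
          rw [mul_add]
          exact add_mem hp hq
        | smul c p _ hp =>
          rw [mul_smul_comm]
          exact Submodule.smul_mem _ _ hp
      · have := add_mem hh (Ideal.mul_mem_left _ (linForm (X a)) hhq)
        convert this using 1
        ring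
    · obtain ⟨η, hη, hηa, hd⟩ := relKernel_coloop hE hU hk
      have hh' : h ∈ subspaceIdeal U := by simpa using dirDeriv_pow_pred_mem hη hηa hd
      refine ⟨g, hg', ?_⟩
      have := add_mem hh (Ideal.mul_mem_left _ (linForm (X a)) hh')
      rwa [sub_add_cancel] at this

end RelativeKernel

/-! ### The internal space as a kernel -/

section InternalSpace

variable {n : ℕ} {ι : Type*} [Fintype ι]

open Classical in
lemma internalP_eq_relKernel {X : ι → Fin n → ℝ} (hX : spanOf X Set.univ = ⊤) :
    internalP X = relKernel X Finset.univ ⊥ 1 := by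
  apply le_antisymm
  · intro f hf H h1 h2 h3 η h0 h4
    obtain ⟨x, -, hx⟩ := exists_notMem_of_sup_eq_top (U := ⊥) (by simpa using hX) bot_le
      (ne_top_of_finrank_add_one h1)
    have hfx : f ∈ centralP X {x}ᶜ := (Submodule.mem_iInf _).1 hf x
    suffices (dirDeriv η ^ ((Finset.univ.filter fun i => X i ∉ H).card - 1)) f = 0 by
      rw [this]; exact zero_mem _
    change f ∈ LinearMap.ker _
    refine (Submodule.span_le.2 ?_ : centralP X {x}ᶜ ≤ _) hfx
    rintro p ⟨Y, hYx, hY, rfl⟩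
    refine dirDeriv_pow_prod_eq_zero η X Y _ ?_
    obtain ⟨i, hi, hiH⟩ := exists_notMem_of_sup_eq_top (U := ⊥) (by simpa using hY) bot_le
      (ne_top_of_finrank_add_one h1)
    have hxY : x ∉ Y := fun h => hYx h rfl
    -- `Y` misses both `x` and, being short in `X \ x`, a further `i` outside `H`: at most `m(H) -
    -- 2` factors respond to `η`.
    have hsub : insert x (insert i (Y.filter fun y => η ⬝ᵥ X y ≠ 0)) ⊆
        Finset.univ.filter fun i => X i ∉ H := by
      intro j hj
      simp only [Finset.mem_insert, Finset.mem_filter] at hj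
      simp only [Finset.mem_filter, Finset.mem_univ, true_and]
      rcases hj with rfl | rfl | hj
      · exact hx
      · exact hiH
      · exact mt (h4 _) hj.2
    have hi2 : i ∉ Y := by simpa using hi.2
    have hix : x ≠ i := fun h => hi.1 h.symm
    have := Finset.card_le_card hsub
    rw [Finset.card_insert_of_notMem (by simp [hxY, hix]),
      Finset.card_insert_of_notMem (by simp [hi2])] at this
    omega
  · intro f hf
    refine (Submodule.mem_iInf _).2 fun x => ?_
    have hins : insert x (Finset.univ.erase x) = (Finset.univ : Finset ι) :=
      Finset.insert_erase (Finset.mem_univ x)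
    have hcoe : ((Finset.univ.erase x : Finset ι) : Set ι) = {x}ᶜ := by ext; simp
    by_cases hx : (⊥ : Submodule ℝ (Fin n → ℝ)) ⊔ spanOf X (Finset.univ.erase x : Finset ι) = ⊤
    · have hf0 : f ∈ relKernel X (Finset.univ.erase x) ⊥ 0 := by
        intro H h1 h2 h3 η h0 h4
        refine dirDeriv_pow_mem_subspaceIdeal (fun u hu => h4 u (h2 hu)) ?_
          (hf H h1 h2 (h3.trans (sup_le_sup le_rfl (spanOf_mono X fun i hi =>
            ⟨Finset.mem_univ i, hi.2⟩))) η h0 h4)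
        -- Deleting `x` lowers `m(H)` by at most one, which absorbs the shift `d = 1`.
        have : (Finset.univ.filter fun i => X i ∉ H) ⊆
            insert x ((Finset.univ.erase x).filter fun i => X i ∉ H) := by
          intro i hi
          by_cases h : i = x <;> simp_all
        have := (Finset.card_le_card this).trans (Finset.card_insert_le _ _)
        omega
      obtain ⟨g, hg, hfg⟩ := exists_sub_mem_of_mem_relKernel_zero X _ ⊥ hx f hf0
      rw [subspaceIdeal_bot, Ideal.mem_bot, sub_eq_zero] at hfg
      subst hfg
      refine Submodule.span_mono ?_ hg
      rintro p ⟨Y, hYE, hY, rfl⟩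
      rw [hcoe, bot_sup_eq] at hY
      exact ⟨Y, hcoe ▸ Finset.coe_subset.2 hYE, hY, rfl⟩
    · obtain ⟨η, -, -, hd⟩ := relKernel_coloop (a := x) (d := 1) hx (by
        rw [hins, Finset.coe_univ, hX, sup_top_eq]) (by rwa [hins])
      rw [subspaceIdeal_bot] at hd
      have : f = 0 := by simpa using hd
      rw [this]
      exact zero_mem _

end InternalSpace

/-! ### Coordinates along a basis -/

section Coordinates

variable {n : ℕ} {ι : Type*} {X : ι → Fin n → ℝ} {B : Finset ι}

open Classical in
/-- The coordinate of vectors at the element `b` of the basis `B`. -/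
def coordOf (X : ι → Fin n → ℝ) (B : Finset ι) (b : ι) : Module.Dual ℝ (Fin n → ℝ) :=
  if h : IsBasisOf X B ∧ b ∈ B then
    (Module.Basis.mk (v := fun b : B => X b) h.1.1 (by
      rw [← h.1.2, spanOf, Set.image_eq_range]; rfl)).coord ⟨b, h.2⟩
  else 0

lemma coordOf_self (hB : IsBasisOf X B) {b : ι} (hb : b ∈ B) : coordOf X B b (X b) = 1 := by
  rw [coordOf, dif_pos ⟨hB, hb⟩]
  exact Module.Basis.mk_coord_apply_eq (v := fun b : B => X b) ⟨b, hb⟩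

lemma coordOf_of_ne (hB : IsBasisOf X B) {b c : ι} (hc : c ∈ B) (h : c ≠ b) :
    coordOf X B b (X c) = 0 := by
  by_cases hb : b ∈ B
  · rw [coordOf, dif_pos ⟨hB, hb⟩]
    exact Module.Basis.mk_coord_apply_ne (v := fun b : B => X b) (i := ⟨b, hb⟩) (j := ⟨c, hc⟩)
      (by simpa using h)
  · rw [coordOf, dif_neg fun h => hb h.2, LinearMap.zero_apply]

lemma sum_coordOf (hB : IsBasisOf X B) (v : Fin n → ℝ) :
    ∑ b ∈ B, coordOf X B b v • X b = v := by
  have hspan : ⊤ ≤ Submodule.span ℝ (Set.range fun b : B => X b) := by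
    rw [← hB.2, spanOf, Set.image_eq_range]; rfl
  have := (Module.Basis.mk hB.1 hspan).sum_repr v
  rw [← Finset.sum_coe_sort]
  conv_rhs => rw [← this]
  refine Finset.sum_congr rfl fun b _ => ?_
  rw [coordOf, dif_pos ⟨hB, b.2⟩, Module.Basis.mk_apply]
  rfl

lemma dual_apply_eq_sum (hB : IsBasisOf X B) (l : Module.Dual ℝ (Fin n → ℝ)) (v : Fin n → ℝ) :
    l v = ∑ b ∈ B, coordOf X B b v * l (X b) := by
  conv_lhs => rw [← sum_coordOf hB v]
  simp

lemma mem_spanOf_iff_coordOf (hB : IsBasisOf X B) {A : Set ι} (hA : A ⊆ B) {v : Fin n → ℝ} :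
    v ∈ spanOf X A ↔ ∀ b ∈ B, b ∉ A → coordOf X B b v = 0 := by
  constructor
  · intro hv b _ hbA
    have : spanOf X A ≤ LinearMap.ker (coordOf X B b) :=
      spanOf_le.2 fun c hc => coordOf_of_ne hB (hA hc) fun h => hbA (h ▸ hc)
    exact this hv
  · intro h
    rw [← sum_coordOf hB v]
    refine Submodule.sum_mem _ fun b hb => ?_
    by_cases hbA : b ∈ A
    · exact Submodule.smul_mem _ _ (mem_spanOf X hbA)
    · simp [h b hb hbA]

lemma mem_spanOf_diff_singleton (hB : IsBasisOf X B) {b : ι} (hb : b ∈ B) {v : Fin n → ℝ} :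
    v ∈ spanOf X ((B : Set ι) \ {b}) ↔ coordOf X B b v = 0 := by
  rw [mem_spanOf_iff_coordOf hB Set.sdiff_subset]
  constructor
  · exact fun h => h b hb (by simp)
  · intro h c hc hcb
    obtain rfl : c = b := by simpa [hc] using hcb
    exact h

lemma notMem_spanOf_diff_singleton {b : ι} (hB : IsBasisOf X B) (hb : b ∈ B) :
    X b ∉ spanOf X ((B : Set ι) \ {b}) := by
  rw [mem_spanOf_diff_singleton hB hb, coordOf_self hB hb]
  exact one_ne_zero

lemma finrank_spanOf_diff_singleton (hB : IsBasisOf X B) {b : ι} (hb : b ∈ B) :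
    Module.finrank ℝ (spanOf X ((B : Set ι) \ {b})) + 1 = n := by
  refine finrank_add_one_of_sup_span_singleton (x := X b) (fun h => ?_) ?_
  · exact notMem_spanOf_diff_singleton hB hb (h ▸ Submodule.mem_top)
  · rw [← spanOf_insert, Set.insert_sdiff_singleton, Set.insert_eq_of_mem (by simpa using hb), hB.2]

lemma IsLastOutside.unique [LinearOrder ι] {H : Submodule ℝ (Fin n → ℝ)} {v w : ι}
    (hv : IsLastOutside X H v) (hw : IsLastOutside X H w) : v = w :=
  le_antisymm (hw.2 v hv.1) (hv.2 w hw.1)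

end Coordinates

/-! ### Modified vectors and the counting inequality -/

section ModifiedVectors

variable {n : ℕ} {ι : Type*} [Fintype ι] [LinearOrder ι] {X : ι → Fin n → ℝ} {B : Finset ι}

lemma mem_passiveSet {y : ι} : y ∈ passiveSet X B ↔ X y ∉ spanOf X {b | b ∈ B ∧ b ≤ y} := by
  simp [passiveSet]

lemma notMem_passiveSet_of_mem {b : ι} (hb : b ∈ B) : b ∉ passiveSet X B := by
  rw [mem_passiveSet, not_not]
  exact mem_spanOf X ⟨hb, le_rfl⟩

lemma le_of_coordOf_ne_zero (hB : IsBasisOf X B) {b y : ι} (hb : b ∈ B) (hy : y ∉ passiveSet X B)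
    (h : coordOf X B b (X y) ≠ 0) : b ≤ y := by
  rw [mem_passiveSet, not_not, mem_spanOf_iff_coordOf hB fun _ h => h.1] at hy
  by_contra hlt
  exact h (hy b hb fun h => hlt h.2)

lemma exists_isLastOutside {H : Submodule ℝ (Fin n → ℝ)} {i : ι} (hi : X i ∉ H) :
    ∃ w, IsLastOutside X H w := by
  classical
  obtain ⟨w, hw, hmax⟩ := Finset.exists_max_image (Finset.univ.filter fun i => X i ∉ H) id
    ⟨i, by simpa using hi⟩
  exact ⟨w, by simpa using hw, fun j hj => hmax j (by simpa using hj)⟩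

/-- All the vectors of `X \ X(B)` but `b` lie in the hyperplane `span (B \ b)`. -/
def IsTight (X : ι → Fin n → ℝ) (B : Finset ι) (b : ι) : Prop :=
  ∀ y, y ∉ passiveSet X B → y ≠ b → X y ∈ spanOf X ((B : Set ι) \ {b})

open Classical in
/-- The tight elements `b` of `B` for which `w` is the last vector outside `span (B \ b)`. -/
def tightSet (X : ι → Fin n → ℝ) (B : Finset ι) (w : ι) : Finset ι :=
  B.filter fun b => IsTight X B b ∧ IsLastOutside X (spanOf X ((B : Set ι) \ {b})) w

lemma mem_tightSet {b w : ι} : b ∈ tightSet X B w ↔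
    b ∈ B ∧ IsTight X B b ∧ IsLastOutside X (spanOf X ((B : Set ι) \ {b})) w := by
  simp [tightSet]

/-- The vector `X w`, with its coordinates at `tightSet X B w` removed. -/
def modVec (X : ι → Fin n → ℝ) (B : Finset ι) (w : ι) : Fin n → ℝ :=
  X w - ∑ b ∈ tightSet X B w, coordOf X B b (X w) • X b

open Classical in
lemma coordOf_modVec (hB : IsBasisOf X B) {b : ι} (hb : b ∈ B) (w : ι) :
    coordOf X B b (modVec X B w) = if b ∈ tightSet X B w then 0 else coordOf X B b (X w) := by
  have : ∀ c ∈ tightSet X B w, coordOf X B c (X w) • coordOf X B b (X c) =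
      if c = b then coordOf X B b (X w) else 0 := by
    intro c hc
    split_ifs with h
    · rw [h, coordOf_self hB hb, smul_eq_mul, mul_one]
    · rw [coordOf_of_ne hB (mem_tightSet.1 hc).1 h, smul_zero]
  rw [modVec, map_sub, map_sum]
  simp only [map_smul]
  rw [Finset.sum_congr rfl this, Finset.sum_ite_eq']
  split_ifs <;> simp

/-- A tight `b` lies outside its own hyperplane, so it precedes the last outside vector `w`;
equality is excluded since `w ∈ X(B)`. -/
lemma sub_modVec_mem {w : ι} (hw : w ∈ passiveSet X B) (hB : IsBasisOf X B) :
    X w - modVec X B w ∈ spanOf X {b | b ∈ B ∧ b < w} := by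
  rw [modVec, sub_sub_cancel]
  refine Submodule.sum_mem _ fun b hb => Submodule.smul_mem _ _ (mem_spanOf X ?_)
  obtain ⟨hb, _, hl⟩ := mem_tightSet.1 hb
  exact ⟨hb, lt_of_le_of_ne (hl.2 b (notMem_spanOf_diff_singleton hB hb))
    fun h => notMem_passiveSet_of_mem hb (h ▸ hw)⟩

/-- Internality enters here: among the vectors not in `X(B)` only `b` is off the hyperplane, and `b`
is not the last one off it. -/
lemma IsTight.mem_passiveSet {b w : ι} (ht : IsTight X B b)
    (hb : ¬ IsLastOutside X (spanOf X ((B : Set ι) \ {b})) b)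
    (hw : IsLastOutside X (spanOf X ((B : Set ι) \ {b})) w) : w ∈ passiveSet X B := by
  by_contra h
  exact hw.1 (ht w h fun h => hb (h ▸ hw))

open Classical in
/-- Outside a hyperplane, the modified vectors are at least two fewer than the vectors. -/
lemma card_filter_modVec_add_two_le (hB : IsBasisOf X B) {E : Finset ι}
    (hE : ∀ i ∈ E, ∀ j, i ≤ j → j ∈ E)
    (hint : ∀ b ∈ B, b ∈ E → ¬ IsLastOutside X (spanOf X ((B : Set ι) \ {b})) b)
    {l : Module.Dual ℝ (Fin n → ℝ)} (hl : l ≠ 0) (hlB : ∀ b ∈ B, b ∉ E → l (X b) = 0) :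
    ((passiveSet X B ∩ E).filter fun y => l (modVec X B y) ≠ 0).card + 2 ≤
      (E.filter fun y => l (X y) ≠ 0).card := by
  have hex : ∀ b, ∃ w, b ∈ B → IsLastOutside X (spanOf X ((B : Set ι) \ {b})) w := by
    intro b
    by_cases hb : b ∈ B
    · obtain ⟨w, hw⟩ := exists_isLastOutside (notMem_spanOf_diff_singleton hB hb)
      exact ⟨w, fun _ => hw⟩
    · exact ⟨b, fun h => absurd h hb⟩
  choose w hw using hex
  -- With these sets the claim reads `|F \ G| + 2 ≤ |O| + |G \ F|`.
  set F := (passiveSet X B ∩ E).filter fun y => l (modVec X B y) ≠ 0 with hF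
  set G := (passiveSet X B ∩ E).filter fun y => l (X y) ≠ 0 with hG
  set O := (E \ passiveSet X B).filter fun y => l (X y) ≠ 0 with hO
  set N := B.filter fun b => l (X b) ≠ 0 with hN
  set T := N.filter fun b => IsTight X B b with hT
  have hNE : ∀ b ∈ N, b ∈ B ∧ l (X b) ≠ 0 ∧ b ∈ E := fun b hb => by
    have := Finset.mem_filter.1 hb
    exact ⟨this.1, this.2, by_contra fun h => this.2 (hlB b this.1 h)⟩
  have hcard : (E.filter fun y => l (X y) ≠ 0).card = G.card + O.card := by
    rw [← Finset.card_union_of_disjoint]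
    · congr 1
      ext y
      simp only [hG, hO, Finset.mem_union, Finset.mem_filter, Finset.mem_inter, Finset.mem_sdiff]
      tauto
    · rw [Finset.disjoint_left]
      intro y hy hy'
      simp only [hG, hO, Finset.mem_filter, Finset.mem_inter, Finset.mem_sdiff] at hy hy'
      tauto
  have hFG : F.card + (G \ F).card = G.card + (F \ G).card := by
    have h1 := Finset.card_sdiff_add_card_inter F G
    have h2 := Finset.card_sdiff_add_card_inter G F
    rw [Finset.inter_comm] at h2
    omega
  -- Modification can turn a zero value of `l` into a nonzero one only by erasing a coordinate at a
  -- tight `b` with `l (X b) ≠ 0`.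
  have hK : F \ G ⊆ T.image w := by
    intro y hy
    obtain ⟨hyF, hyG⟩ := Finset.mem_sdiff.1 hy
    obtain ⟨hyE, hly⟩ := Finset.mem_filter.1 hyF
    have hly0 : l (X y) = 0 := by
      by_contra h
      exact hyG (Finset.mem_filter.2 ⟨hyE, h⟩)
    have : ∃ b ∈ tightSet X B y, l (X b) ≠ 0 := by
      by_contra! h
      refine hly ?_
      rw [modVec, map_sub, map_sum, hly0, Finset.sum_eq_zero, sub_zero]
      intro b hb
      rw [map_smul, h b hb, smul_zero]
    obtain ⟨b, hb, hlb⟩ := this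
    obtain ⟨hbB, hbt, hby⟩ := mem_tightSet.1 hb
    exact Finset.mem_image.2 ⟨b, Finset.mem_filter.2 ⟨Finset.mem_filter.2 ⟨hbB, hlb⟩, hbt⟩,
      (hw b hbB).unique hby⟩
  have hNO : N ⊆ O := fun b hb => by
    obtain ⟨h1, h2, h3⟩ := hNE b hb
    exact Finset.mem_filter.2 ⟨Finset.mem_sdiff.2 ⟨h3, notMem_passiveSet_of_mem h1⟩, h2⟩
  have hKT : (F \ G).card ≤ T.card := (Finset.card_le_card hK).trans Finset.card_image_le
  by_cases hall : ∀ b ∈ N, IsTight X B b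
  · have hTN : T = N := Finset.filter_true_of_mem hall
    rw [hTN] at hK
    have hNne : N.Nonempty := by
      by_contra h
      rw [Finset.not_nonempty_iff_eq_empty, hN, Finset.filter_eq_empty_iff] at h
      refine hl (LinearMap.ext fun v => ?_)
      rw [dual_apply_eq_sum hB, LinearMap.zero_apply]
      refine Finset.sum_eq_zero fun b hb => ?_
      rw [not_not.1 (h hb), mul_zero]
    -- The largest value `w c` is not in `F`: its coordinates along `N` are erased, or vanish
    -- because `w b` is earlier. This saves one; the second saving is a collision of `w` on `N`, or
    -- else `w c ∈ G \ F`.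
    obtain ⟨c, hcN, hmax⟩ := Finset.exists_max_image N w hNne
    obtain ⟨hcB, hlc, hcE⟩ := hNE c hcN
    have hlt : ∀ b ∈ N, w b ≠ w c → coordOf X B b (X (w c)) = 0 := by
      intro b hb hbc
      by_contra h
      have hbB := (hNE b hb).1
      exact hbc (le_antisymm (hmax b hb)
        ((hw b hbB).2 _ (mt (mem_spanOf_diff_singleton hB hbB).1 h)))
    have hwcp : w c ∈ passiveSet X B := (hall c hcN).mem_passiveSet (hint c hcB hcE) (hw c hcB)
    have hwcE : w c ∈ passiveSet X B ∩ E := Finset.mem_inter.2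
      ⟨hwcp, hE c hcE _ ((hw c hcB).2 c (notMem_spanOf_diff_singleton hB hcB))⟩
    have hwF : w c ∉ F := by
      intro h
      refine (Finset.mem_filter.1 h).2 ?_
      rw [dual_apply_eq_sum hB]
      refine Finset.sum_eq_zero fun b hb => ?_
      by_cases hlb : l (X b) = 0
      · rw [hlb, mul_zero]
      have hbN : b ∈ N := Finset.mem_filter.2 ⟨hb, hlb⟩
      rw [coordOf_modVec hB hb]
      split_ifs with hbt
      · rw [zero_mul]
      · rw [hlt b hbN fun h => hbt (mem_tightSet.2 ⟨hb, hall b hbN, h ▸ hw b hb⟩), zero_mul]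
    have hKe : F \ G ⊆ (N.image w).erase (w c) := fun y hy =>
      Finset.mem_erase.2 ⟨fun h => hwF (h ▸ (Finset.mem_sdiff.1 hy).1), hK hy⟩
    have hcK := Finset.card_le_card hKe
    have hwcI : w c ∈ N.image w := Finset.mem_image_of_mem w hcN
    rw [Finset.card_erase_of_mem hwcI] at hcK
    have hpos := Finset.card_pos.2 ⟨_, hwcI⟩
    have hNOc := Finset.card_le_card hNO
    have hIN : (N.image w).card ≤ N.card := Finset.card_image_le
    by_cases hI : (N.image w).card = N.card
    · have hinj := Finset.card_image_iff.1 hI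
      have hwG : w c ∈ G := by
        refine Finset.mem_filter.2 ⟨hwcE, ?_⟩
        rw [dual_apply_eq_sum hB, Finset.sum_eq_single c]
        · exact mul_ne_zero (mt (mem_spanOf_diff_singleton hB hcB).2 (hw c hcB).1) hlc
        · intro b hb hbc
          by_cases hlb : l (X b) = 0
          · rw [hlb, mul_zero]
          have hbN : b ∈ N := Finset.mem_filter.2 ⟨hb, hlb⟩
          rw [hlt b hbN fun h => hbc (hinj hbN hcN h), zero_mul]
        · exact fun h => absurd hcB h
      have := Finset.card_pos.2 ⟨w c, Finset.mem_sdiff.2 ⟨hwG, hwF⟩⟩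
      omega
    · omega
  · push Not at hall
    obtain ⟨b, hbN, hbt⟩ := hall
    obtain ⟨hbB, hlb, hbE⟩ := hNE b hbN
    obtain ⟨y, hyp, hyb, hy⟩ : ∃ y, y ∉ passiveSet X B ∧ y ≠ b ∧
        X y ∉ spanOf X ((B : Set ι) \ {b}) := by
      simpa [IsTight] using hbt
    rw [mem_spanOf_diff_singleton hB hbB] at hy
    have hyE : y ∈ E := hE b hbE y (le_of_coordOf_ne_zero hB hbB hyp hy)
    -- Non-tightness of `b`, witnessed by `y`, gives a second element of `O` outside `T`: `y`
    -- itself, or, if `l` kills `y`, another basis vector whose tightness `y` also violates. Hence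
    -- `|T| + 2 ≤ |O|`.
    obtain ⟨z, hzO, hzb, hzT⟩ : ∃ z ∈ O, z ≠ b ∧ z ∉ T := by
      by_cases hly : l (X y) = 0
      · have : ∃ z ∈ B, z ≠ b ∧ coordOf X B z (X y) * l (X z) ≠ 0 := by
          by_contra! h
          rw [dual_apply_eq_sum hB, Finset.sum_eq_single b h (fun h => absurd hbB h)] at hly
          exact mul_ne_zero hy hlb hly
        obtain ⟨z, hzB, hzb, hz⟩ := this
        have hlz := right_ne_zero_of_mul hz
        refine ⟨z, hNO (Finset.mem_filter.2 ⟨hzB, hlz⟩), hzb, fun hzT => ?_⟩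
        refine left_ne_zero_of_mul hz ((mem_spanOf_diff_singleton hB hzB).1
          ((Finset.mem_filter.1 hzT).2 y hyp fun h => hlz (h ▸ hly)))
      · exact ⟨y, Finset.mem_filter.2 ⟨Finset.mem_sdiff.2 ⟨hyE, hyp⟩, hly⟩, hyb, fun hyT =>
          hy (coordOf_of_ne hB (hNE y (Finset.mem_filter.1 hyT).1).1 hyb)⟩
    have hsub : insert z (insert b T) ⊆ O := by
      refine Finset.insert_subset hzO (Finset.insert_subset (hNO hbN) ?_)
      exact (Finset.filter_subset _ _).trans hNO
    have := Finset.card_le_card hsub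
    rw [Finset.card_insert_of_notMem (by simp [hzb, hzT]),
      Finset.card_insert_of_notMem (by simp [hT, hbt])] at this
    omega

end ModifiedVectors

lemma mem_iff_lt_of_upper {ι : Type*} [LinearOrder ι] {a : ι} {s : Finset ι} (has : ∀ i ∈ s, a < i)
    (hup : ∀ i ∈ insert a s, ∀ j, i ≤ j → j ∈ insert a s) (i : ι) : i ∈ s ↔ a < i :=
  ⟨has i, fun h => (Finset.mem_insert.1 (hup a (Finset.mem_insert_self _ _) i h.le)).resolve_left
    h.ne'⟩

/-! ### Independence and spanning over final segments -/

section RelativeModifiedPolynomials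

variable {n : ℕ} {ι : Type*} [Fintype ι] [LinearOrder ι] {X : ι → Fin n → ℝ} {B : Finset ι}

/-- The product of the modified linear forms at the elements of `X(B)` in `E`. -/
def relModPoly (X : ι → Fin n → ℝ) (B E : Finset ι) : MvPolynomial (Fin n) ℂ :=
  ∏ y ∈ passiveSet X B ∩ E, linForm (modVec X B y)

lemma relModPoly_insert_of_mem {a : ι} {s : Finset ι} (has : a ∉ s) (ha : a ∈ passiveSet X B) :
    relModPoly X B (insert a s) = linForm (modVec X B a) * relModPoly X B s := by
  rw [relModPoly, Finset.inter_insert_of_mem ha, Finset.prod_insert (by simp [has]), relModPoly]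

lemma relModPoly_insert_of_notMem {a : ι} {s : Finset ι} (ha : a ∉ passiveSet X B) :
    relModPoly X B (insert a s) = relModPoly X B s := by
  rw [relModPoly, Finset.inter_insert_of_notMem ha, relModPoly]

lemma mem_passiveSet_iff_sdiff {a : ι} {s : Finset ι} (hs : ∀ i, i ∈ s ↔ a < i) :
    a ∈ passiveSet X B ↔ X a ∉ spanOf X (B \ s : Finset ι) := by
  rw [mem_passiveSet]
  have : {b | b ∈ B ∧ b ≤ a} = ((B \ s : Finset ι) : Set ι) := by
    ext b
    simp [hs]
  rw [this]

lemma linForm_modVec_sub_mem (hB : IsBasisOf X B) {a : ι} {s : Finset ι}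
    (hs : ∀ i, i ∈ s ↔ a < i) (ha : a ∈ passiveSet X B) :
    linForm (X a) - linForm (modVec X B a) ∈ subspaceIdeal (spanOf X (B \ s : Finset ι)) := by
  rw [← linForm_sub]
  refine linForm_mem_subspaceIdeal (spanOf_mono X ?_ (sub_modVec_mem ha hB))
  intro b hb
  simpa [hs] using ⟨hb.1, hb.2.le⟩

lemma relModPoly_mem_relKernel (hB : IsBasisOf X B) {E : Finset ι}
    (hE : ∀ i ∈ E, ∀ j, i ≤ j → j ∈ E)
    (hint : ∀ b ∈ B, b ∈ E → ¬ IsLastOutside X (spanOf X ((B : Set ι) \ {b})) b) :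
    relModPoly X B E ∈ relKernel X E (spanOf X (B \ E : Finset ι)) 1 := by
  classical
  intro H h1 h2 _ η h0 hη
  rw [relModPoly, dirDeriv_pow_prod_eq_zero]
  · exact zero_mem _
  have := card_filter_modVec_add_two_le hB hE hint (l := dotProductEquiv ℝ (Fin n) η)
    (by simpa using h0) fun b hb hbE =>
      hη _ (h2 (mem_spanOf X (Finset.mem_coe.2 (Finset.mem_sdiff.2 ⟨hb, hbE⟩))))
  simp only [dotProductEquiv_apply_apply, ne_eq, dotProduct_eq_zero_iff_mem h1 h0 hη] at this ⊢
  omega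

open Classical in
/-- The modified polynomials of the bases with a given part outside the final segment `E` are
independent modulo the ideal of that part. -/
lemma relModPoly_independent (X : ι → Fin n → ℝ) (E : Finset ι) :
    (∀ i ∈ E, ∀ j, i ≤ j → j ∈ E) → ∀ (C : Finset ι) (c : Finset ι → ℂ),
      ∑ B ∈ Finset.univ.filter (fun B => IsBasisOf X B ∧ B \ E = C), c B • relModPoly X B E ∈
        subspaceIdeal (spanOf X C) → ∀ B, IsBasisOf X B → B \ E = C → c B = 0 := by
  induction E using Finset.induction_on_min with
  | empty =>
    intro _ C c h B hB hBC
    rw [Finset.sdiff_empty] at hBC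
    subst hBC
    rw [Finset.sum_eq_single B] at h
    · simpa [relModPoly] using constantCoeff_of_mem_subspaceIdeal h
    · intro D hD hDB
      exact absurd (by simpa using (Finset.mem_filter.1 hD).2.2) hDB
    · intro h
      simp [hB] at h
  | insert a s has ih =>
    intro hup C c h B hB hBC
    have hs := mem_iff_lt_of_upper has hup
    have ih := ih fun i hi j hij => (hs j).2 (((hs i).1 hi).trans_le hij)
    have hns : a ∉ s := fun h => lt_irrefl a (has a h)
    have haC : a ∉ C := by
      rw [← hBC]
      simp
    have hd1 : ∀ D : Finset ι, (D \ insert a s = C ∧ a ∉ D) ↔ D \ s = C := by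
      intro D
      simp only [Finset.ext_iff, Finset.mem_sdiff, Finset.mem_insert]
      grind
    have hd2 : ∀ D : Finset ι, (D \ insert a s = C ∧ a ∈ D) ↔ D \ s = insert a C := by
      intro D
      simp only [Finset.ext_iff, Finset.mem_sdiff, Finset.mem_insert]
      grind
    rw [← Finset.sum_filter_add_sum_filter_not _ (fun D => a ∈ D), Finset.filter_filter,
      Finset.filter_filter] at h
    simp only [and_assoc, hd1, hd2] at h
    by_cases haU : X a ∈ spanOf X C
    · have hno : ∀ D, IsBasisOf X D → D \ s ≠ insert a C := by
        intro D hD hDC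
        have haD := ((hd2 D).2 hDC).2
        refine notMem_spanOf_diff_singleton hD haD (spanOf_mono X (fun i hi => ?_) haU)
        have : i ∈ D \ s := hDC ▸ Finset.mem_insert_of_mem hi
        exact ⟨(Finset.mem_sdiff.1 this).1, fun h => haC (h ▸ hi)⟩
      rw [Finset.filter_false_of_mem (fun D _ h => hno D h.1 h.2), Finset.sum_empty, zero_add] at h
      have haB : a ∉ B := fun haB => hno B hB ((hd2 B).1 ⟨hBC, haB⟩)
      refine ih C c ?_ B hB ((hd1 B).1 ⟨hBC, haB⟩)
      convert h using 1
      refine Finset.sum_congr rfl fun D hD => ?_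
      rw [relModPoly_insert_of_notMem]
      rwa [mem_passiveSet_iff_sdiff hs, (Finset.mem_filter.1 hD).2.2, not_not]
    · have hpass : ∀ D ∈ Finset.univ.filter (fun D => IsBasisOf X D ∧ D \ s = C),
          a ∈ passiveSet X D ∧
          linForm (X a) - linForm (modVec X D a) ∈ subspaceIdeal (spanOf X C) := by
        intro D hD
        obtain ⟨-, hD, hDC⟩ := Finset.mem_filter.1 hD
        have h1 : a ∈ passiveSet X D := by rwa [mem_passiveSet_iff_sdiff hs, hDC]
        exact ⟨h1, hDC ▸ linForm_modVec_sub_mem hD hs h1⟩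
      have h2 : ∑ D ∈ Finset.univ.filter (fun D => IsBasisOf X D ∧ D \ s = insert a C),
          c D • relModPoly X D (insert a s) =
          ∑ D ∈ Finset.univ.filter (fun D => IsBasisOf X D ∧ D \ s = insert a C),
          c D • relModPoly X D s := by
        refine Finset.sum_congr rfl fun D hD => ?_
        rw [relModPoly_insert_of_notMem]
        exact notMem_passiveSet_of_mem ((hd2 D).2 (Finset.mem_filter.1 hD).2.2).2
      have h1 : linForm (X a) * ∑ D ∈ Finset.univ.filter (fun D => IsBasisOf X D ∧ D \ s = C),
          c D • relModPoly X D s - ∑ D ∈ Finset.univ.filter (fun D => IsBasisOf X D ∧ D \ s = C),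
          c D • relModPoly X D (insert a s) ∈ subspaceIdeal (spanOf X C) := by
        rw [Finset.mul_sum, ← Finset.sum_sub_distrib]
        refine Ideal.sum_mem _ fun D hD => ?_
        obtain ⟨hp, hm⟩ := hpass D hD
        rw [relModPoly_insert_of_mem hns hp, mul_smul_comm, ← smul_sub, ← sub_mul, smul_eq_C_mul]
        exact Ideal.mul_mem_left _ _ (Ideal.mul_mem_right _ _ hm)
      have hle : subspaceIdeal (spanOf X C) ≤ subspaceIdeal (spanOf X (insert a C : Finset ι)) :=
        subspaceIdeal_mono (spanOf_mono X (by simp))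
      have haI : linForm (X a) ∈ subspaceIdeal (spanOf X (insert a C : Finset ι)) :=
        linForm_mem_subspaceIdeal (mem_spanOf X (by simp))
      rw [h2] at h
      -- Modulo the forms of `span (C ∪ a)` the bases avoiding `a` contribute multiples of `linForm
      -- (X a)`, hence nothing.
      have hc2 := ih (insert a C) c (by
        have := add_mem (hle h) (hle h1)
        rw [add_add_sub_cancel, add_comm] at this
        exact (Ideal.add_mem_iff_right _ (Ideal.mul_mem_right _ _ haI)).1 this)
      by_cases haB : a ∈ B
      · exact hc2 B hB ((hd2 B).1 ⟨hBC, haB⟩)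
      -- The bases through `a` are gone, so the factor `linForm (X a)` cancels.
      · refine ih C c (mem_subspaceIdeal_of_linForm_mul haU ?_) B hB ((hd1 B).1 ⟨hBC, haB⟩)
        rw [Finset.sum_eq_zero, zero_add] at h
        · have := add_mem h1 h
          rwa [sub_add_cancel] at this
        · intro D hD
          rw [hc2 D (Finset.mem_filter.1 hD).2.1 (Finset.mem_filter.1 hD).2.2, zero_smul]

open Classical in
/-- The modified polynomials of the bases with the part `C` outside the final segment `E` that are
internal at the elements of `E` span `relKernel` modulo the ideal of `C`. -/
lemma exists_sub_mem_of_mem_relKernel_one (X : ι → Fin n → ℝ) (E : Finset ι) :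
    (∀ i ∈ E, ∀ j, i ≤ j → j ∈ E) → ∀ C : Finset ι, Disjoint C E → LinearIndepOn ℝ X C →
      spanOf X C ⊔ spanOf X E = ⊤ → ∀ f ∈ relKernel X E (spanOf X C) 1,
      ∃ g ∈ Submodule.span ℂ {p | ∃ B, IsBasisOf X B ∧ B \ E = C ∧ (∀ b ∈ B, b ∈ E →
        ¬ IsLastOutside X (spanOf X ((B : Set ι) \ {b})) b) ∧ p = relModPoly X B E},
        f - g ∈ subspaceIdeal (spanOf X C) := by
  induction E using Finset.induction_on_min with
  | empty =>
    intro _ C _ hC hspan f _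
    rw [Finset.coe_empty, spanOf_empty, sup_bot_eq] at hspan
    refine ⟨MvPolynomial.C (constantCoeff f), ?_, hspan ▸ sub_C_mem_subspaceIdeal_top f⟩
    rw [← mul_one (MvPolynomial.C _), ← smul_eq_C_mul]
    exact Submodule.smul_mem _ _ (Submodule.subset_span
      ⟨C, ⟨hC, hspan⟩, by simp, by simp, by simp [relModPoly]⟩)
  | insert a s has ih =>
    intro hup C hdisj hC hspan f hf
    have hs := mem_iff_lt_of_upper has hup
    have ih := ih fun i hi j hij => (hs j).2 (((hs i).1 hi).trans_le hij)
    have hns : a ∉ s := fun h => lt_irrefl a (has a h)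
    have haC : a ∉ C := fun h => Finset.disjoint_left.1 hdisj h (Finset.mem_insert_self a s)
    have hdisj' : Disjoint C s := hdisj.mono_right (Finset.subset_insert a s)
    have hd1 : ∀ D : Finset ι, (D \ insert a s = C ∧ a ∉ D) ↔ D \ s = C := by
      intro D
      simp only [Finset.ext_iff, Finset.mem_sdiff, Finset.mem_insert]
      grind
    have hd2 : ∀ D : Finset ι, (D \ insert a s = C ∧ a ∈ D) ↔ D \ s = insert a C := by
      intro D
      simp only [Finset.ext_iff, Finset.mem_sdiff, Finset.mem_insert]
      grind
    rw [Finset.coe_insert, spanOf_insert] at hspan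
    by_cases haU : X a ∈ spanOf X C
    · rw [← sup_assoc, sup_eq_left.2 ((Submodule.span_singleton_le_iff_mem _ _).2 haU)] at hspan
      obtain ⟨g, hg, hfg⟩ := ih C hdisj' hC hspan f (relKernel_loop haU hf)
      refine ⟨g, Submodule.span_mono ?_ hg, hfg⟩
      rintro p ⟨B, hB, hBC, hint, rfl⟩
      obtain ⟨hBC', haB⟩ := (hd1 B).2 hBC
      refine ⟨B, hB, hBC', fun b hb hbs => hint b hb ?_, ?_⟩
      · exact (Finset.mem_insert.1 hbs).resolve_left fun h => haB (h ▸ hb)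
      · rw [relModPoly_insert_of_notMem]
        rwa [mem_passiveSet_iff_sdiff hs, hBC, not_not]
    by_cases hcol : spanOf X C ⊔ spanOf X s = ⊤
    swap
    -- For a coloop the exponent is `1 - 1 = 0`, so `f` itself is in the ideal.
    · obtain ⟨η, -, -, hd⟩ := relKernel_coloop hcol
        (by rw [Finset.coe_insert, spanOf_insert, hspan]) hf
      exact ⟨0, zero_mem _, by simpa using hd⟩
    have hCa : spanOf X (insert a C : Finset ι) = spanOf X C ⊔ Submodule.span ℝ {X a} := by
      rw [Finset.coe_insert, spanOf_insert, sup_comm]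
    obtain ⟨g, hg, hfg⟩ := ih (insert a C) (Finset.disjoint_insert_left.2 ⟨hns, hdisj'⟩)
      (by rw [Finset.coe_insert]; exact hC.insert haU) (by rw [hCa, sup_assoc, hspan]) f
      (hCa ▸ relKernel_contract hf)
    have hgen : ∀ p, (∃ B, IsBasisOf X B ∧ B \ s = insert a C ∧ (∀ b ∈ B, b ∈ s →
        ¬ IsLastOutside X (spanOf X ((B : Set ι) \ {b})) b) ∧ p = relModPoly X B s) →
        ∃ B, IsBasisOf X B ∧ B \ insert a s = C ∧ (∀ b ∈ B, b ∈ insert a s →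
        ¬ IsLastOutside X (spanOf X ((B : Set ι) \ {b})) b) ∧
        p = relModPoly X B (insert a s) := by
      rintro p ⟨B, hB, hBC, hint, rfl⟩
      obtain ⟨hBC', haB⟩ := (hd2 B).2 hBC
      refine ⟨B, hB, hBC', fun b hb hbs => ?_, ?_⟩
      · rcases Finset.mem_insert.1 hbs with rfl | hbs
        -- Internality at `a` is automatic: were `a` last outside the hyperplane, all of `C` and `s`
        -- would lie in it, against `hcol`.
        · intro hlast
          refine ne_top_of_finrank_add_one (finrank_spanOf_diff_singleton hB haB)
            (top_le_iff.1 (hcol ▸ sup_le (spanOf_mono X fun i hi => ?_)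
              (spanOf_le.2 fun i hi => ?_)))
          · have : i ∈ B \ s := hBC ▸ Finset.mem_insert_of_mem hi
            exact ⟨(Finset.mem_sdiff.1 this).1, fun h => haC (h ▸ hi)⟩
          · by_contra h
            exact absurd (hlast.2 i h) (not_le.2 (has i hi))
        · exact hint b hb hbs
      · rw [relModPoly_insert_of_notMem (notMem_passiveSet_of_mem haB)]
    have hg' := Submodule.span_mono hgen hg
    have hgk : g ∈ relKernel X (insert a s) (spanOf X C) 1 := by
      refine Submodule.span_le.2 ?_ hg'
      rintro p ⟨B, hB, hBC, hint, rfl⟩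
      rw [← hBC]
      exact relModPoly_mem_relKernel hB hup hint
    obtain ⟨h, hh⟩ := exists_sub_linForm_mul_mem (hCa ▸ hfg)
    have hk : linForm (X a) * h ∈ relKernel X (insert a s) (spanOf X C) 1 := by
      have := sub_mem (sub_mem hf hgk) (subspaceIdeal_le_relKernel hh)
      rwa [sub_sub_cancel] at this
    obtain ⟨q, hq, hhq⟩ := ih C hdisj' hC hcol h (relKernel_delete hns haU hk)
    have hmul : ∃ r ∈ Submodule.span ℂ {p | ∃ B, IsBasisOf X B ∧ B \ insert a s = C ∧
        (∀ b ∈ B, b ∈ insert a s → ¬ IsLastOutside X (spanOf X ((B : Set ι) \ {b})) b) ∧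
        p = relModPoly X B (insert a s)},
        linForm (X a) * q - r ∈ subspaceIdeal (spanOf X C) := by
      clear hhq
      induction hq using Submodule.span_induction with
      | mem p hp =>
        obtain ⟨B, hB, hBC, hint, rfl⟩ := hp
        obtain ⟨hBC', haB⟩ := (hd1 B).2 hBC
        have hp : a ∈ passiveSet X B := by rwa [mem_passiveSet_iff_sdiff hs, hBC]
        refine ⟨_, Submodule.subset_span ⟨B, hB, hBC', fun b hb hbs => hint b hb ?_, rfl⟩, ?_⟩
        · exact (Finset.mem_insert.1 hbs).resolve_left fun h => haB (h ▸ hb)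
        · rw [relModPoly_insert_of_mem hns hp, ← sub_mul]
          exact Ideal.mul_mem_right _ _ (hBC ▸ linForm_modVec_sub_mem hB hs hp)
      | zero => exact ⟨0, zero_mem _, by simp⟩
      | add p q _ _ hp hq =>
        obtain ⟨r, hr, hpr⟩ := hp
        obtain ⟨t, ht, hqt⟩ := hq
        refine ⟨r + t, add_mem hr ht, ?_⟩
        rw [mul_add, add_sub_add_comm]
        exact add_mem hpr hqt
      | smul c p _ hp =>
        obtain ⟨r, hr, hpr⟩ := hp
        refine ⟨c • r, Submodule.smul_mem _ _ hr, ?_⟩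
        rw [mul_smul_comm, ← smul_sub, smul_eq_C_mul]
        exact Ideal.mul_mem_left _ _ hpr
    obtain ⟨r, hr, hqr⟩ := hmul
    refine ⟨g + r, add_mem hg' hr, ?_⟩
    have := add_mem (add_mem hh (Ideal.mul_mem_left _ (linForm (X a)) hhq)) hqr
    convert this using 1
    ring

end RelativeModifiedPolynomials

/-! ### Identification of the replaced vectors -/

section Replacement

variable {n : ℕ} {ι : Type*} [Fintype ι] [LinearOrder ι] {X : ι → Fin n → ℝ} {B : Finset ι}

/-- The derivative survives exactly when at most one vector outside `X(B)` is off `H`. As `B` spans,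
that vector is some `b ∈ B`, and the rest of `B` spans `H`. -/
lemma mem_badHyperplanes (hB : IsBasisOf X B) {H : Submodule ℝ (Fin n → ℝ)} :
    H ∈ badHyperplanes X B ↔ ∃ b ∈ B, IsTight X B b ∧ H = spanOf X ((B : Set ι) \ {b}) := by
  classical
  have hnum : ∀ H : Submodule ℝ (Fin n → ℝ),
      numOutside X H = (Finset.univ.filter fun i => X i ∉ H).card := fun H => by
    rw [numOutside, ← Set.ncard_coe_finset]
    congr 1
    ext i
    simp
  constructor
  · rintro ⟨⟨hrank, -⟩, η, h0, hη, hne⟩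
    have hle := not_lt.1 (mt (dirDeriv_pow_prod_eq_zero η X (passiveSet X B) _) hne)
    obtain ⟨b, hb, hbH⟩ := exists_notMem_of_sup_eq_top (U := ⊥) (by simpa using hB.2) bot_le
      (ne_top_of_finrank_add_one hrank)
    have hother : ∀ y, y ∉ passiveSet X B → y ≠ b → X y ∈ H := by
      intro y hy hyb
      by_contra hyH
      have hsub : insert y (insert b ((passiveSet X B).filter fun y => η ⬝ᵥ X y ≠ 0)) ⊆
          Finset.univ.filter fun i => X i ∉ H := by
        intro i hi
        simp only [Finset.mem_insert, Finset.mem_filter, Finset.mem_univ, true_and] at hi ⊢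
        rcases hi with rfl | rfl | hi
        · exact hyH
        · exact hbH
        · exact mt (hη _) hi.2
      have := Finset.card_le_card hsub
      rw [Finset.card_insert_of_notMem (by simp [hyb, hy]),
        Finset.card_insert_of_notMem (by simp [notMem_passiveSet_of_mem hb])] at this
      rw [hnum] at hle
      omega
    have hH : spanOf X ((B : Set ι) \ {b}) = H := by
      refine Submodule.eq_of_le_of_finrank_eq (spanOf_le.2 fun c hc => ?_) ?_
      · exact hother c (notMem_passiveSet_of_mem hc.1) (by simpa using hc.2)
      · have := finrank_spanOf_diff_singleton hB hb
        omega
    exact ⟨b, hb, by rwa [IsTight, hH], hH.symm⟩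
  · rintro ⟨b, hb, ht, rfl⟩
    have hbH := notMem_spanOf_diff_singleton hB hb
    have hrank := finrank_spanOf_diff_singleton hB hb
    obtain ⟨η, hη, hηb⟩ := exists_normal hbH
    have h0 : η ≠ 0 := fun h => hηb (by simp [h])
    refine ⟨⟨hrank, le_antisymm (spanOf_le.2 fun i hi => hi)
      (spanOf_mono X fun i hi => mem_spanOf X hi)⟩, η, h0, hη, ?_⟩
    refine dirDeriv_pow_prod_ne_zero η (fun y hy h => ?_) _ ?_
    · rw [mem_passiveSet, h] at hy
      exact hy (zero_mem _)
    · have hsub : (Finset.univ.filter fun i => X i ∉ spanOf X ((B : Set ι) \ {b})) ⊆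
          insert b ((passiveSet X B).filter fun y => η ⬝ᵥ X y ≠ 0) := by
        intro i hi
        rw [Finset.mem_filter] at hi
        by_cases hib : i = b
        · simp [hib]
        refine Finset.mem_insert_of_mem (Finset.mem_filter.2 ⟨by_contra fun h => ?_, ?_⟩)
        · exact hi.2 (ht i h hib)
        · exact mt (dotProduct_eq_zero_iff_mem hrank h0 hη).1 hi.2
      have := (Finset.card_le_card hsub).trans (Finset.card_insert_le _ _)
      rw [hnum]
      omega

lemma shieldSet_eq_tightSet (hB : IsBasisOf X B) (w : ι) : shieldSet X B w = tightSet X B w := by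
  ext x
  simp only [shieldSet, Finset.mem_filter, Finset.mem_univ, true_and, mem_tightSet]
  have key : ∀ b ∈ B, IsTight X B b →
      {i | i ∉ passiveSet X B ∧ X i ∉ spanOf X ((B : Set ι) \ {b})} = {b} := by
    intro b hb ht
    ext i
    simp only [Set.mem_ofPred_eq, Set.mem_singleton_iff]
    refine ⟨fun hi => by_contra fun h => hi.2 (ht i hi.1 h), ?_⟩
    rintro rfl
    exact ⟨notMem_passiveSet_of_mem hb, notMem_spanOf_diff_singleton hB hb⟩
  constructor
  · rintro ⟨H, hH, hw, hx⟩
    obtain ⟨b, hb, ht, rfl⟩ := (mem_badHyperplanes hB).1 hH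
    rw [key b hb ht, Set.singleton_eq_singleton_iff] at hx
    exact hx ▸ ⟨hb, ht, hw⟩
  · rintro ⟨hx, ht, hw⟩
    exact ⟨_, (mem_badHyperplanes hB).2 ⟨x, hx, ht, rfl⟩, hw, key x hx ht⟩

lemma mem_replacedSet (hB : IsBasisOf X B) {w : ι} :
    w ∈ replacedSet X B ↔ (tightSet X B w).Nonempty := by
  simp only [replacedSet, Finset.mem_filter, Finset.mem_univ, true_and]
  constructor
  · rintro ⟨H, hH, hw⟩
    obtain ⟨b, hb, ht, rfl⟩ := (mem_badHyperplanes hB).1 hH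
    exact ⟨b, mem_tightSet.2 ⟨hb, ht, hw⟩⟩
  · rintro ⟨b, hb⟩
    obtain ⟨hb, ht, hw⟩ := mem_tightSet.1 hb
    exact ⟨_, (mem_badHyperplanes hB).2 ⟨b, hb, ht, rfl⟩, hw⟩

lemma mem_flag (hB : IsBasisOf X B) {w : ι} {v : Fin n → ℝ} :
    v ∈ flag X B w ↔ ∀ u ≤ w, ∀ b ∈ tightSet X B u, coordOf X B b v = 0 := by
  rw [flag, Submodule.mem_sInf]
  constructor
  · intro h u hu b hb
    obtain ⟨hb, ht, hl⟩ := mem_tightSet.1 hb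
    exact (mem_spanOf_diff_singleton hB hb).1
      (h _ ⟨(mem_badHyperplanes hB).2 ⟨b, hb, ht, rfl⟩, u, hu, hl⟩)
  · rintro h H ⟨hH, u, hu, hl⟩
    obtain ⟨b, hb, ht, rfl⟩ := (mem_badHyperplanes hB).1 hH
    exact (mem_spanOf_diff_singleton hB hb).2 (h u hu b (mem_tightSet.2 ⟨hb, ht, hl⟩))

/-- Coordinates at the tight `b` of `w` vanish on the flag, which forces the coefficients.
Conversely, coordinates of `X w` at tight elements with an earlier last vector already vanish. -/
lemma isReplacement_iff (hB : IsBasisOf X B) {w : ι} {v : Fin n → ℝ} :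
    IsReplacement X B w v ↔ v = modVec X B w := by
  rw [IsReplacement, shieldSet_eq_tightSet hB]
  constructor
  · rintro ⟨hv, a, -, hw⟩
    have ha : ∀ b ∈ tightSet X B w, coordOf X B b (X w) = a b := by
      intro b hb
      have hbB := (mem_tightSet.1 hb).1
      rw [hw, map_add, (mem_flag hB).1 hv w le_rfl b hb, zero_add, map_sum,
        Finset.sum_eq_single b]
      · rw [map_smul, coordOf_self hB hbB, smul_eq_mul, mul_one]
      · intro c hc hcb
        rw [map_smul, coordOf_of_ne hB (mem_tightSet.1 hc).1 hcb, smul_zero]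
      · exact fun h => absurd hb h
    rw [modVec, Finset.sum_congr rfl fun b hb => by rw [ha b hb]]
    exact eq_sub_of_add_eq hw.symm
  · rintro rfl
    refine ⟨(mem_flag hB).2 fun u hu b hb => ?_, fun b => coordOf X B b (X w), ?_, ?_⟩
    · obtain ⟨hbB, ht, hl⟩ := mem_tightSet.1 hb
      rw [coordOf_modVec hB hbB]
      split_ifs with h
      · rfl
      · by_contra hne
        obtain rfl : u = w :=
          le_antisymm hu (hl.2 w (mt (mem_spanOf_diff_singleton hB hbB).1 hne))
        exact h hb
    · intro b hb
      obtain ⟨hbB, -, hl⟩ := mem_tightSet.1 hb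
      exact mt (mem_spanOf_diff_singleton hB hbB).2 hl.1
    · rw [modVec, sub_add_cancel]

lemma replacement_eq_modVec (hB : IsBasisOf X B) (w : ι) : replacement X B w = modVec X B w := by
  have h : ∃ v, IsReplacement X B w v := ⟨_, (isReplacement_iff hB).2 rfl⟩
  rw [replacement, dif_pos h]
  exact (isReplacement_iff hB).1 h.choose_spec

lemma replacedSet_subset_passiveSet (hB : B ∈ internalBases X) :
    replacedSet X B ⊆ passiveSet X B := by
  intro w hw
  obtain ⟨b, hb⟩ := (mem_replacedSet hB.1).1 hw
  obtain ⟨hb, ht, hl⟩ := mem_tightSet.1 hb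
  exact ht.mem_passiveSet (hB.2 b hb) hl

lemma modifiedPoly_eq_relModPoly (hB : B ∈ internalBases X) :
    modifiedPoly X B = relModPoly X B Finset.univ := by
  classical
  rw [relModPoly, Finset.inter_univ, ← Finset.prod_sdiff (replacedSet_subset_passiveSet hB),
    modifiedPoly, prodForm]
  congr 1
  · refine Finset.prod_congr (by congr!) fun y hy => ?_
    have : tightSet X B y = ∅ := by
      rw [← Finset.not_nonempty_iff_eq_empty, ← mem_replacedSet hB.1]
      exact (Finset.mem_sdiff.1 hy).2
    rw [modVec, this, Finset.sum_empty, sub_zero]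
  · exact Finset.prod_congr rfl fun y _ => by rw [replacement_eq_modVec hB.1]

lemma isHomogeneous_modifiedPoly (hB : B ∈ internalBases X) :
    (modifiedPoly X B).IsHomogeneous (passiveSet X B).card := by
  rw [modifiedPoly_eq_relModPoly hB, relModPoly, Finset.inter_univ, Finset.card_eq_sum_ones]
  exact IsHomogeneous.prod _ _ _ fun y _ => isHomogeneous_linForm _

end Replacement

/-! ### The basis and the Hilbert series -/

section Basis

variable {n : ℕ} {ι : Type*} [Fintype ι] [LinearOrder ι] {X : ι → Fin n → ℝ}

lemma linearIndependent_modifiedPoly (X : ι → Fin n → ℝ) :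
    LinearIndependent ℂ fun B : internalBases X => modifiedPoly X (B : Finset ι) := by
  classical
  rw [Fintype.linearIndependent_iff]
  intro c hc B
  -- `relModPoly_independent` covers all bases, so the relation is extended by zero.
  set c' : Finset ι → ℂ := fun D => if h : D ∈ internalBases X then c ⟨D, h⟩ else 0 with hc'
  have hsum : ∑ D ∈ Finset.univ.filter (fun D => IsBasisOf X D ∧ D \ Finset.univ = ∅),
      c' D • relModPoly X D Finset.univ = 0 := by
    rw [← hc, ← Finset.sum_subset (s₁ := (internalBases X).toFinset)]
    · rw [Finset.sum_subtype (p := (· ∈ internalBases X)) _ fun D => Set.mem_toFinset]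
      refine Finset.sum_congr rfl fun D _ => ?_
      rw [modifiedPoly_eq_relModPoly D.2]
      simp [hc']
    · intro D hD
      rw [Set.mem_toFinset] at hD
      simp [hD.1]
    · intro D _ hD
      rw [Set.mem_toFinset] at hD
      simp [hc', hD]
  have := relModPoly_independent X Finset.univ (by simp) ∅ c'
    (by rw [hsum]; exact zero_mem _) B B.2.1 (by simp)
  simpa [hc', B.2] using this

lemma span_modifiedPoly (hX : spanOf X Set.univ = ⊤) :
    Submodule.span ℂ (modifiedPoly X '' internalBases X) = internalP X := by
  classical
  rw [internalP_eq_relKernel hX]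
  apply le_antisymm
  · refine Submodule.span_le.2 ?_
    rintro _ ⟨B, hB, rfl⟩
    have := relModPoly_mem_relKernel hB.1 (E := Finset.univ) (by simp) fun b hb _ => hB.2 b hb
    rw [Finset.sdiff_eq_empty_iff_subset.2 (Finset.subset_univ B), Finset.coe_empty,
      spanOf_empty] at this
    rw [modifiedPoly_eq_relModPoly hB]
    exact this
  · intro f hf
    have h0 : spanOf X ((∅ : Finset ι) : Set ι) = ⊥ := by rw [Finset.coe_empty, spanOf_empty]
    obtain ⟨g, hg, hfg⟩ := exists_sub_mem_of_mem_relKernel_one X Finset.univ (by simp) ∅ (by simp)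
      (by rw [Finset.coe_empty]; exact linearIndepOn_empty ℝ X)
      (by rw [Finset.coe_univ, hX, sup_top_eq]) f (by rwa [h0])
    rw [h0, subspaceIdeal_bot, Ideal.mem_bot, sub_eq_zero] at hfg
    subst hfg
    refine Submodule.span_mono ?_ hg
    rintro p ⟨B, hB, -, hint, rfl⟩
    have hBi : B ∈ internalBases X := ⟨hB, fun b hb => hint b hb (Finset.mem_univ b)⟩
    exact ⟨B, hBi, modifiedPoly_eq_relModPoly hBi⟩

lemma internalHilbert_eq (hX : spanOf X Set.univ = ⊤) (j : ℕ) :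
    internalHilbert X j = Set.ncard {B | B ∈ internalBases X ∧ (passiveSet X B).card = j} := by
  classical
  set S := {B | B ∈ internalBases X ∧ (passiveSet X B).card = j} with hS
  have hspan : internalP X ⊓ homogeneousSubmodule (Fin n) ℂ j =
      Submodule.span ℂ (Set.range fun B : S => modifiedPoly X (B : Finset ι)) := by
    rw [← span_modifiedPoly hX]
    apply le_antisymm
    · rintro f ⟨hf, hfj⟩
      -- Writing `f` as its own degree `j` component lets the span induction forget homogeneity.
      rw [← if_pos (c := j = j) rfl (t := f) (e := 0), ← homogeneousComponent_of_mem hfj]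
      clear hfj
      induction hf using Submodule.span_induction with
      | mem p hp =>
        obtain ⟨B, hB, rfl⟩ := hp
        rw [homogeneousComponent_of_mem
          ((mem_homogeneousSubmodule _ _).2 (isHomogeneous_modifiedPoly hB))]
        split_ifs with h
        · exact Submodule.subset_span ⟨⟨B, hB, h.symm⟩, rfl⟩
        · exact zero_mem _
      | zero => simp
      | add p q _ _ hp hq =>
        rw [map_add]
        exact add_mem hp hq
      | smul c p _ hp =>
        rw [map_smul]
        exact Submodule.smul_mem _ _ hp
    · refine Submodule.span_le.2 ?_
      rintro _ ⟨⟨B, hB, hj⟩, rfl⟩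
      refine ⟨Submodule.subset_span ⟨B, hB, rfl⟩, ?_⟩
      have := isHomogeneous_modifiedPoly hB
      rwa [hj] at this
  have hind : LinearIndependent ℂ fun B : S => modifiedPoly X (B : Finset ι) :=
    (linearIndependent_modifiedPoly X).comp (fun B : S => (⟨B, B.2.1⟩ : internalBases X))
      fun B D h => Subtype.ext (congrArg (fun E : internalBases X => (E : Finset ι)) h)
  rw [internalHilbert, hspan, finrank_span_eq_card hind, ← Nat.card_eq_fintype_card,
    Nat.card_coe_set_eq]

end Basis

end Zonotopal

end

theorem mainTheorem12 {n : ℕ} {ι : Type*} [Fintype ι] [LinearOrder ι] (X : ι → Fin n → ℝ)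
    (hX0 : ∀ i, X i ≠ 0) (hXspan : Submodule.span ℝ (Set.range X) = ⊤) :
    -- the modified polynomials are well defined
    (∀ B ∈ Zonotopal.internalBases X, Zonotopal.replacedSet X B ⊆ Zonotopal.passiveSet X B ∧
      ∀ w ∈ Zonotopal.replacedSet X B, ∃! v, Zonotopal.IsReplacement X B w v) ∧
    -- they form a basis of the internal space
    LinearIndependent ℂ
      (fun B : Zonotopal.internalBases X => Zonotopal.modifiedPoly X (B : Finset ι)) ∧
    Submodule.span ℂ (Zonotopal.modifiedPoly X '' Zonotopal.internalBases X) =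
      Zonotopal.internalP X ∧
    -- the internal Hilbert series
    ∀ j : ℕ, Zonotopal.internalHilbert X j =
      Set.ncard {B | B ∈ Zonotopal.internalBases X ∧ (Zonotopal.passiveSet X B).card = j} := by
  have hX : Zonotopal.spanOf X Set.univ = ⊤ := by rw [Zonotopal.spanOf, Set.image_univ, hXspan]
  exact ⟨fun B hB => ⟨Zonotopal.replacedSet_subset_passiveSet hB, fun w _ =>
      ⟨_, (Zonotopal.isReplacement_iff hB.1).2 rfl,
        fun _ hv => (Zonotopal.isReplacement_iff hB.1).1 hv⟩⟩,
    Zonotopal.linearIndependent_modifiedPoly X, Zonotopal.span_modifiedPoly hX,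
    Zonotopal.internalHilbert_eq hX⟩
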